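/- Let $a,b,c,\sigma$ be measurable functions on $[0,\infty)$ with values in $M_{d_1}(\mathbb R)$, $M_{d_1,m_1}(\mathbb R)$, $M_{d_2,d_1}(\mathbb R)$, $M_{d_2,m_2}(\mathbb R)$ such that $\int_0^t\bigl(|a(s)|+|b(s)|^2+|c(s)|^2+|\sigma(s)|^2\bigr)ds<\infty$ for every $t\ge 0$ ($|\cdot|$ the Frobenius norm), and such that for some constant $C>0$ all eigenvalues of $\sigma(t)\sigma(t)^\top$ are $>C$ for every $t\ge0$. Let $(\Omega,\mathcal F,P)$ be a probability space carrying a (possibly degenerate) normal random vector $X_0$ in $\mathbb R^{d_1}$, with covariance matrix $\Sigma=V[X_0]$, and an $m_1$-dimensional standard Brownian motion $\tilde V$. For each $t\ge0$ let $\phi(\cdot\,;t)$ be the symmetric negative semidefinite solution on $[0,t]$ of the matrix Riccati equation $$\frac{d\phi}{ds}(s;t)=-\phi(s;t)b(s)b(s)^\top\phi(s;t)-a(s)^\top\phi(s;t)-\phi(s;t)a(s)+c(s)^\top(\sigma(s)\sigma(s)^\top)^{-1}c(s),\qquad \phi(t;t)=0,$$ understood in integrated form, and let $(\xi_{s;t})_{0\le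 s\le t}$ be a solution with continuous paths of $$d_s\xi_{s;t}=\{a(s)+b(s)b(s)^\top\phi(s;t)\}\,\xi_{s;t}\,ds+b(s)\,d\tilde V_s,$$ where $\xi_{0;t}$ is a normal random vector, independent of $\tilde V$, with mean $0$ and covariance matrix $\Sigma^{1/2}\bigl(I-\Sigma^{1/2}\phi(0;t)\Sigma^{1/2}\bigr)^{-1}\Sigma^{1/2}$. Then every $\xi_{s;t}$ ($0\le s\le t$) is square integrable, and for all $s,u\ge0$ and $t\ge s\vee u$, $$d_t\,\mathrm{Cov}(\xi_{s;t},\xi_{u;t})=-\mathrm{Cov}(\xi_{t;t},\xi_{s;t})^\top c(t)^\top(\sigma(t)\sigma(t)^\top)^{-1}c(t)\,\mathrm{Cov}(\xi_{t;t},\xi_{u;t})\,dt,$$ that is, the function $v\mapsto \mathrm{Cov}(\xi_{v;v},\xi_{s;v})^\top c(v)^\top(\sigma(v)\sigma(v)^\top)^{-1}c(v)\,\mathrm{Cov}(\xi_{v;v},\xi_{u;v})$ is integrable on $[s\vee u,t]$ and $$\mathrm{Cov}(\xi_{s;t},\xi_{u;t})=\mathrm{Cov}(\xi_{s;s\vee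 u},\xi_{u;s\vee u})-\int_{s\vee u}^t\mathrm{Cov}(\xi_{v;v},\xi_{s;v})^\top c(v)^\top(\sigma(v)\sigma(v)^\top)^{-1}c(v)\,\mathrm{Cov}(\xi_{v;v},\xi_{u;v})\,dv .$$ -/

import Mathlib

open MeasureTheory ProbabilityTheory Filter Topology
open scoped NNReal ENNReal Matrix MatrixOrder

namespace LinearFiltering

/-- The Frobenius norm of a real matrix. -/
noncomputable def frobenius {m n : ℕ} (A : Matrix (Fin m) (Fin n) ℝ) : ℝ :=
  √(∑ i, ∑ j, A i j ^ 2)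

/-- The standing assumptions on the coefficients of the linear system
`dX = a X dt + b dV`, `dY = c X dt + σ dW`: measurability, local integrability of `a`, local
square integrability of `b`, `c`, `σ`, and a uniform positive lower bound for the eigenvalues of
`σ σᵀ`. -/
structure Coefficients {d₁ d₂ m₁ m₂ : ℕ}
    (a : ℝ → Matrix (Fin d₁) (Fin d₁) ℝ) (b : ℝ → Matrix (Fin d₁) (Fin m₁) ℝ)
    (c : ℝ → Matrix (Fin d₂) (Fin d₁) ℝ) (σ : ℝ → Matrix (Fin d₂) (Fin m₂) ℝ) : Prop where
  measurable_a : ∀ i j, Measurable fun s => a s i j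
  measurable_b : ∀ i j, Measurable fun s => b s i j
  measurable_c : ∀ i j, Measurable fun s => c s i j
  measurable_σ : ∀ i j, Measurable fun s => σ s i j
  integrable_a : ∀ t, 0 ≤ t → IntegrableOn (fun s => frobenius (a s)) (Set.Icc 0 t)
  integrable_b : ∀ t, 0 ≤ t → IntegrableOn (fun s => frobenius (b s) ^ 2) (Set.Icc 0 t)
  integrable_c : ∀ t, 0 ≤ t → IntegrableOn (fun s => frobenius (c s) ^ 2) (Set.Icc 0 t)
  integrable_σ : ∀ t, 0 ≤ t → IntegrableOn (fun s => frobenius (σ s) ^ 2) (Set.Icc 0 t)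
  elliptic : ∃ C : ℝ, 0 < C ∧ ∀ t, 0 ≤ t → ∀ μ ∈ spectrum ℝ (σ t * (σ t)ᵀ), C < μ

/-- The matrix `cᵀ (σ σᵀ)⁻¹ c` for one value of the time. -/
noncomputable def obsInfo {d₁ d₂ m₂ : ℕ} (c : Matrix (Fin d₂) (Fin d₁) ℝ)
    (σ : Matrix (Fin d₂) (Fin m₂) ℝ) : Matrix (Fin d₁) (Fin d₁) ℝ :=
  cᵀ * (σ * σᵀ)⁻¹ * c

/-- The right-hand side of the Riccati equation at the matrix `p`, for one value of the time. -/
noncomputable def riccatiRHS {d₁ d₂ m₁ m₂ : ℕ}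
    (a : Matrix (Fin d₁) (Fin d₁) ℝ) (b : Matrix (Fin d₁) (Fin m₁) ℝ)
    (c : Matrix (Fin d₂) (Fin d₁) ℝ) (σ : Matrix (Fin d₂) (Fin m₂) ℝ)
    (p : Matrix (Fin d₁) (Fin d₁) ℝ) : Matrix (Fin d₁) (Fin d₁) ℝ :=
  -(p * b * bᵀ * p) - aᵀ * p - p * a + obsInfo c σ

/-- `p : [0, t] → ℝ^{d₁ × d₁}` is a negative semidefinite symmetric solution of the backward
Riccati equation `p' = - p b bᵀ p - aᵀ p - p a + cᵀ (σ σᵀ)⁻¹ c`, `p t = 0`. The coefficients being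
only measurable, the equation is understood in the sense of Carathéodory, i.e. integrated. -/
structure IsRiccatiSolution {d₁ d₂ m₁ m₂ : ℕ}
    (a : ℝ → Matrix (Fin d₁) (Fin d₁) ℝ) (b : ℝ → Matrix (Fin d₁) (Fin m₁) ℝ)
    (c : ℝ → Matrix (Fin d₂) (Fin d₁) ℝ) (σ : ℝ → Matrix (Fin d₂) (Fin m₂) ℝ)
    (t : ℝ) (p : ℝ → Matrix (Fin d₁) (Fin d₁) ℝ) : Prop where
  negSemidef : ∀ s ∈ Set.Icc 0 t, (-p s).PosSemidef
  integrable : ∀ i j,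
    IntervalIntegrable (fun r => riccatiRHS (a r) (b r) (c r) (σ r) (p r) i j) volume 0 t
  equation : ∀ s ∈ Set.Icc 0 t, ∀ i j,
    p s i j = -∫ r in s..t, riccatiRHS (a r) (b r) (c r) (σ r) (p r) i j

/-- A step function `∑ₖ coeffₖ 1_{(leftₖ, rightₖ]}` on the half-line. -/
structure StepFun where
  size : ℕ
  coeff : Fin size → ℝ
  left : Fin size → ℝ≥0
  right : Fin size → ℝ≥0
  left_le_right : ∀ k, left k ≤ right k

/-- The value of a step function. -/
noncomputable def StepFun.eval (g : StepFun) (r : ℝ) : ℝ :=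
  ∑ k, (Set.Ioc (g.left k : ℝ) (g.right k)).indicator (fun _ => g.coeff k) r

/-- The elementary integral of a step function against the process `B`. -/
noncomputable def StepFun.integral {Ω : Type*} (g : StepFun) (B : ℝ≥0 → Ω → ℝ) (ω : Ω) : ℝ :=
  ∑ k, g.coeff k * (B (g.right k) ω - B (g.left k) ω)

/-- `V` is an `m`-dimensional standard Brownian motion under `P`. -/
structure IsBrownianVec {Ω : Type*} [MeasurableSpace Ω] (P : Measure Ω) {m : ℕ}
    (V : Fin m → ℝ≥0 → Ω → ℝ) : Prop where
  brownian : ∀ k, IsBrownianReal (V k) P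
  indep : iIndepFun (fun k ω r => V k r ω) P

/-- `J` is (a version of) the stochastic integral `∫₀ˢ f(r)ᵀ dV_r` of the deterministic function
`f` against the `m`-dimensional Brownian motion `V`: it is the `L²(P)` limit of the elementary
integrals of step functions which converge to `f 1_{(0, s]}` in `L²`. -/
def IsWienerIntegral {Ω : Type*} [MeasurableSpace Ω] (P : Measure Ω) {m : ℕ}
    (V : Fin m → ℝ≥0 → Ω → ℝ) (f : ℝ → Fin m → ℝ) (s : ℝ) (J : Ω → ℝ) : Prop :=
  ∃ g : ℕ → Fin m → StepFun,
    (∀ k, Tendsto (fun n => eLpNorm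
      (fun r => (g n k).eval r - (Set.Ioc 0 s).indicator (fun r => f r k) r) 2 volume)
      atTop (𝓝 0)) ∧
    Tendsto (fun n => eLpNorm (fun ω => (∑ k, (g n k).integral (V k) ω) - J ω) 2 P) atTop (𝓝 0)

/-- The cross-covariance matrix `Cov(ξ, η) = (cov(ξ_i, η_j))_{i,j}` of two random vectors. -/
noncomputable def covMatrix {Ω : Type*} [MeasurableSpace Ω] (P : Measure Ω) {d : ℕ}
    (ξ η : Ω → Fin d → ℝ) : Matrix (Fin d) (Fin d) ℝ :=
  Matrix.of fun i j => cov[fun ω => ξ ω i, fun ω => η ω j; P]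

/-- The matrix `S^{1/2} (I - S^{1/2} p S^{1/2})⁻¹ S^{1/2}`. -/
noncomputable def initialCov {d : ℕ} (S p : Matrix (Fin d) (Fin d) ℝ) :
    Matrix (Fin d) (Fin d) ℝ :=
  CFC.sqrt S * (1 - CFC.sqrt S * p * CFC.sqrt S)⁻¹ * CFC.sqrt S

/-- For a fixed horizon `t`, `ξ = (ξ_s)_{0 ≤ s ≤ t}` is a solution of
`dξ_s = (a(s) + b(s) b(s)ᵀ p(s)) ξ_s ds + b(s) dV_s` on `[0, t]`, whose initial value is a centred
normal vector with covariance matrix `initialCov S (p 0)`, independent of `V`. -/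
structure IsXi {Ω : Type*} [MeasurableSpace Ω] (P : Measure Ω) {d₁ m₁ : ℕ}
    (a : ℝ → Matrix (Fin d₁) (Fin d₁) ℝ) (b : ℝ → Matrix (Fin d₁) (Fin m₁) ℝ)
    (S : Matrix (Fin d₁) (Fin d₁) ℝ) (V : Fin m₁ → ℝ≥0 → Ω → ℝ)
    (t : ℝ) (p : ℝ → Matrix (Fin d₁) (Fin d₁) ℝ) (ξ : ℝ → Ω → Fin d₁ → ℝ) : Prop where
  gaussian_zero : HasGaussianLaw (ξ 0) P
  mean_zero : ∀ i, ∫ ω, ξ 0 ω i ∂P = 0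
  cov_zero : covMatrix P (ξ 0) (ξ 0) = initialCov S (p 0)
  indep_zero : IndepFun (ξ 0) (fun ω k r => V k r ω) P
  aemeasurable : ∀ s ∈ Set.Icc 0 t, AEMeasurable (ξ s) P
  continuous : ∀ᵐ ω ∂P, ContinuousOn (fun s => ξ s ω) (Set.Icc 0 t)
  sde : ∀ s ∈ Set.Icc 0 t, ∀ i, IsWienerIntegral P V (fun r => b r i) s fun ω =>
    ξ s ω i - ξ 0 ω i - ∫ r in (0 : ℝ)..s, ((a r + b r * (b r)ᵀ * p r) *ᵥ ξ r ω) i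

end LinearFiltering

/-!
For a fixed horizon `v` the process `ξ_{·;v}` solves a linear equation with drift matrix
`A = a + b bᵀ φ(·;v)`. Let `Φ` be the fundamental matrix of `A` with `Φ(0) = 1`, let `Ψ = Φ⁻¹`, and
put `S(s) = Var ξ_{0;v} + ∫₀ˢ Ψ b bᵀ Ψᵀ`. Pairing the equation with a fixed square integrable
variable, successively with the initial value, with the noise and with the solution itself, turns
it into a deterministic linear equation, and this yields `Cov(ξ_s, ξ_u) = Φ(s) S(s) Φ(u)ᵀ` for
`s ≤ u ≤ v` (`IsLinearSolution.covMatrix_eq`).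

The right-hand side depends on `v` through `φ(·;v)`. That dependence is made explicit by the linear
Hamiltonian system `U' = a U + b bᵀ W`, `W' = h U - aᵀ W`, where `h = cᵀ (σ σᵀ)⁻¹ c`. If `(U, W)` is
any solution and `p = φ(·;v)`, then `W - p U` solves `D' = -Aᵀ D`, so that `Φᵀ (W - p U)` is
constant. Apply this to the solution `(U, W)` which starts from `(Σ, 1)` at time `0` and to the
solution `(P_u, R_u)` which starts from `(0, 1)` at time `u`. As `p` vanishes at `v`, and as the
initial covariance is `Σ (1 - p(0) Σ)⁻¹`, the outcome is that `W(v)` is invertible and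
`Cov(ξ_s, ξ_u) = U(s) W(v)⁻¹ R_u(v)` (`fundamental_mul_eq_hamiltonian`), where `U`, `W` and `R_u` do
not depend on the horizon.

It remains to differentiate in `v`, which gives `U(s) W⁻¹ h (P_u - U W⁻¹ R_u)`. Here `U(s) W(v)⁻¹`
is `Cov(ξ_s, ξ_v)`, and `U W⁻¹ R_u - P_u` is `Cov(ξ_v, ξ_u)`, because the symplectic form of two
solutions of the Hamiltonian system is constant (`isPrimitiveOn_horizon`).

The coefficients are only integrable, so all derivatives are understood in the integrated sense
(`IsPrimitiveOn`), and solutions of linear equations come from the Picard series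
(`exists_linear_solution`).
-/

namespace LinearFiltering

/-! ### Absolutely continuous matrix functions -/

section Primitive

theorem intervalIntegrable_mono {f : ℝ → ℝ} {α β α' β' : ℝ} (hf : IntervalIntegrable f volume α β)
    (hα : α ≤ α') (h : α' ≤ β') (hβ : β' ≤ β) : IntervalIntegrable f volume α' β' := by
  refine hf.mono_set ?_
  rw [Set.uIcc_of_le h, Set.uIcc_of_le (hα.trans (h.trans hβ))]
  exact Set.Icc_subset_Icc hα hβ

theorem primitive_continuousOn {α β : ℝ} (hαβ : α ≤ β) {f f' : ℝ → ℝ}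
    (hf' : IntervalIntegrable f' volume α β)
    (hf : ∀ s ∈ Set.Icc α β, f s = f α + ∫ r in α..s, f' r) : ContinuousOn f (Set.Icc α β) := by
  have h1 : ContinuousOn (fun s => f α + ∫ r in α..s, f' r) (Set.Icc α β) := by
    refine continuousOn_const.add ?_
    have := intervalIntegral.continuousOn_primitive_interval' (b₁ := α) (b₂ := β) hf'
      (a := α) Set.left_mem_uIcc
    rwa [Set.uIcc_of_le hαβ] at this
  exact h1.congr hf

/-- The product rule for absolutely continuous functions, in integrated form. -/
theorem primitive_mul {α β : ℝ} (hαβ : α ≤ β) {f f' g g' : ℝ → ℝ}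
    (hf' : IntervalIntegrable f' volume α β)
    (hf : ∀ s ∈ Set.Icc α β, f s = f α + ∫ r in α..s, f' r)
    (hg' : IntervalIntegrable g' volume α β)
    (hg : ∀ s ∈ Set.Icc α β, g s = g α + ∫ r in α..s, g' r) :
    IntervalIntegrable (fun r => f' r * g r + f r * g' r) volume α β ∧
    ∀ s ∈ Set.Icc α β, f s * g s = f α * g α + ∫ r in α..s, (f' r * g r + f r * g' r) := by
  have hfc := primitive_continuousOn hαβ hf' hf
  have hgc := primitive_continuousOn hαβ hg' hg
  rw [← Set.uIcc_of_le hαβ] at hfc hgc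
  refine ⟨(hf'.mul_continuousOn hgc).add (hg'.continuousOn_mul hfc), fun s hs => ?_⟩
  have hsub : Set.uIcc α s ⊆ Set.uIcc α β := by
    rw [Set.uIcc_of_le hs.1, Set.uIcc_of_le hαβ]; exact Set.Icc_subset_Icc_right hs.2
  have hfs : IntervalIntegrable f' volume α s := hf'.mono_set hsub
  have hgs : IntervalIntegrable g' volume α s := hg'.mono_set hsub
  -- Differentiability holds for the integrals below, with which `f` and `g` agree on the interval.
  have key : ∀ {k k' : ℝ → ℝ}, IntervalIntegrable k' volume α s →
      AbsolutelyContinuousOnInterval (fun x => k α + ∫ r in α..x, k' r) α s ∧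
      ∀ᵐ x, x ∈ Set.uIcc α s → HasDerivAt (fun x => k α + ∫ r in α..x, k' r) (k' x) x := by
    intro k k' hk
    constructor
    · have hconst : LipschitzOnWith 0 (fun _ : ℝ => k α) (Set.uIcc α s) :=
        (LipschitzWith.const _).lipschitzOnWith
      exact hconst.absolutelyContinuousOnInterval.add
        (hk.absolutelyContinuousOnInterval_intervalIntegral Set.left_mem_uIcc)
    · filter_upwards [hk.ae_hasDerivAt_integral] with x hx hxs
      exact (hx hxs α Set.left_mem_uIcc).const_add _
  obtain ⟨hfa, hfd⟩ := key (k := f) hfs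
  obtain ⟨hga, hgd⟩ := key (k := g) hgs
  have h := hfa.integral_deriv_mul_eq_sub hga
  simp only [intervalIntegral.integral_same, add_zero] at h
  rw [← hf s hs, ← hg s hs] at h
  have : ∫ r in α..s, (f' r * g r + f r * g' r) = f s * g s - f α * g α := by
    rw [← h]
    apply intervalIntegral.integral_congr_ae
    filter_upwards [hfd, hgd] with x hx hx' hxs
    have hxs' := Set.uIoc_subset_uIcc hxs
    have hxI : x ∈ Set.Icc α β := by simpa [Set.uIcc_of_le hαβ] using hsub hxs'
    rw [(hx hxs').deriv, (hx' hxs').deriv, ← hf x hxI, ← hg x hxI]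
  rw [this]; ring

/-- On `[α, β]` the matrix function `F` is, entry by entry, the indefinite integral of the
integrable function `F'`: it is absolutely continuous there, with derivative `F'` almost
everywhere. -/
structure IsPrimitiveOn {m n : Type*} (α β : ℝ) (F F' : ℝ → Matrix m n ℝ) : Prop where
  integrable : ∀ i j, IntervalIntegrable (fun r => F' r i j) volume α β
  eq : ∀ s ∈ Set.Icc α β, ∀ i j, F s i j = F α i j + ∫ r in α..s, F' r i j

namespace IsPrimitiveOn

variable {k m n : Type*} {α β : ℝ} {F F' : ℝ → Matrix m n ℝ} {G G' : ℝ → Matrix m n ℝ}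

theorem continuousOn (h : IsPrimitiveOn α β F F') (hαβ : α ≤ β) (i : m) (j : n) :
    ContinuousOn (fun s => F s i j) (Set.Icc α β) :=
  primitive_continuousOn hαβ (h.integrable i j) fun s hs => h.eq s hs i j

theorem mul [Fintype n] {G G' : ℝ → Matrix n k ℝ} (hF : IsPrimitiveOn α β F F')
    (hG : IsPrimitiveOn α β G G') (hαβ : α ≤ β) :
    IsPrimitiveOn α β (fun s => F s * G s) (fun s => F' s * G s + F s * G' s) := by
  have key := fun i l j => primitive_mul hαβ (hF.integrable i l) (fun s hs => hF.eq s hs i l)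
    (hG.integrable l j) (fun s hs => hG.eq s hs l j)
  have hint : ∀ i j, ∀ l ∈ Finset.univ, IntervalIntegrable
      (fun r => F' r i l * G r l j + F r i l * G' r l j) volume α β := fun i j l _ => (key i l j).1
  have hval : ∀ i j r, (F' r * G r + F r * G' r) i j =
      ∑ l, (F' r i l * G r l j + F r i l * G' r l j) := by
    intro i j r; simp [Matrix.mul_apply, Finset.sum_add_distrib]
  constructor
  · intro i j
    simp only [hval]
    exact (IntervalIntegrable.sum Finset.univ (hint i j)).congr fun r _ => by simp
  · intro s hs i j
    simp only [hval, Matrix.mul_apply]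
    rw [intervalIntegral.integral_finsetSum fun l hl =>
        intervalIntegrable_mono (hint i j l hl) le_rfl hs.1 hs.2,
      ← Finset.sum_add_distrib]
    exact Finset.sum_congr rfl fun l _ => (key i l j).2 s hs

theorem transpose (hF : IsPrimitiveOn α β F F') :
    IsPrimitiveOn α β (fun s => (F s)ᵀ) (fun s => (F' s)ᵀ) :=
  ⟨fun i j => hF.integrable j i, fun s hs i j => hF.eq s hs j i⟩

theorem sub (hF : IsPrimitiveOn α β F F') (hG : IsPrimitiveOn α β G G') :
    IsPrimitiveOn α β (fun s => F s - G s) (fun s => F' s - G' s) := by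
  refine ⟨fun i j => (hF.integrable i j).sub (hG.integrable i j), fun s hs i j => ?_⟩
  simp only [Matrix.sub_apply]
  rw [intervalIntegral.integral_sub (intervalIntegrable_mono (hF.integrable i j) le_rfl hs.1 hs.2)
    (intervalIntegrable_mono (hG.integrable i j) le_rfl hs.1 hs.2), hF.eq s hs i j, hG.eq s hs i j]
  ring

theorem const (A : Matrix m n ℝ) : IsPrimitiveOn α β (fun _ => A) 0 :=
  ⟨fun i j => by simp, fun s hs i j => by simp⟩

theorem congr (hF : IsPrimitiveOn α β F F') (h : ∀ s ∈ Set.Icc α β, F s = G s)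
    (h' : ∀ s ∈ Set.Icc α β, F' s = G' s) (hαβ : α ≤ β) : IsPrimitiveOn α β G G' := by
  constructor
  · intro i j
    refine (hF.integrable i j).congr fun r hr => ?_
    rw [Set.uIoc_of_le hαβ] at hr
    simp only [h' r (Set.Ioc_subset_Icc_self hr)]
  · intro s hs i j
    rw [← h s hs, ← h α ⟨le_rfl, hαβ⟩, hF.eq s hs i j]
    congr 1
    refine intervalIntegral.integral_congr fun r hr => ?_
    rw [Set.uIcc_of_le hs.1] at hr
    simp only [h' r ⟨hr.1, hr.2.trans hs.2⟩]

theorem mono (hF : IsPrimitiveOn α β F F') {α' β' : ℝ} (hα : α ≤ α') (hβ : β' ≤ β)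
    (h : α' ≤ β') : IsPrimitiveOn α' β' F F' := by
  have hint : ∀ {x y}, α ≤ x → x ≤ y → y ≤ β → ∀ i j,
      IntervalIntegrable (fun r => F' r i j) volume x y := fun hx hxy hy i j =>
    intervalIntegrable_mono (hF.integrable i j) hx hxy hy
  refine ⟨hint hα h hβ, fun s hs i j => ?_⟩
  rw [hF.eq s ⟨hα.trans hs.1, hs.2.trans hβ⟩ i j, hF.eq α' ⟨hα, h.trans hβ⟩ i j, add_assoc,
    intervalIntegral.integral_add_adjacent_intervals (hint le_rfl hα (h.trans hβ) i j)
      (hint hα hs.1 (hs.2.trans hβ) i j)]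

theorem exists_primitive
    (h : ∀ i j, IntervalIntegrable (fun r => F' r i j) volume α β) (F₀ : Matrix m n ℝ) :
    ∃ F : ℝ → Matrix m n ℝ, F α = F₀ ∧ IsPrimitiveOn α β F F' :=
  ⟨fun s => F₀ + Matrix.of fun i j => ∫ r in α..s, F' r i j, by ext; simp, h,
    fun s _ i j => by simp⟩

/-- A primitive of zero is constant. -/
theorem eq_of_zero (hF : IsPrimitiveOn α β F F') (h : ∀ s ∈ Set.Icc α β, F' s = 0) :
    ∀ s ∈ Set.Icc α β, F s = F α := by
  intro s hs
  ext i j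
  rw [hF.eq s hs i j, intervalIntegral.integral_congr (g := fun _ => 0)]
  · simp
  · intro r hr
    rw [Set.uIcc_of_le hs.1] at hr
    simp [h r ⟨hr.1, hr.2.trans hs.2⟩]

end IsPrimitiveOn

/-- Entrywise integrability of a product of a continuous and an integrable matrix function. -/
theorem intervalIntegrable_mul_left {k m n : Type*} [Fintype n] {α β : ℝ} (hαβ : α ≤ β)
    {F : ℝ → Matrix m n ℝ} {H : ℝ → Matrix n k ℝ}
    (hF : ∀ i j, ContinuousOn (fun s => F s i j) (Set.Icc α β))
    (hH : ∀ i j, IntervalIntegrable (fun r => H r i j) volume α β) (i : m) (j : k) :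
    IntervalIntegrable (fun r => (F r * H r) i j) volume α β := by
  simp only [Matrix.mul_apply]
  exact (IntervalIntegrable.sum Finset.univ
    (fun l _ => (hH l j).continuousOn_mul (by rw [Set.uIcc_of_le hαβ]; exact hF i l))).congr
    fun r _ => by simp

theorem intervalIntegrable_mul_right {k m n : Type*} [Fintype n] {α β : ℝ} (hαβ : α ≤ β)
    {F : ℝ → Matrix n k ℝ} {H : ℝ → Matrix m n ℝ}
    (hF : ∀ i j, ContinuousOn (fun s => F s i j) (Set.Icc α β))
    (hH : ∀ i j, IntervalIntegrable (fun r => H r i j) volume α β) (i : m) (j : k) :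
    IntervalIntegrable (fun r => (H r * F r) i j) volume α β := by
  simp only [Matrix.mul_apply]
  exact (IntervalIntegrable.sum Finset.univ
    (fun l _ => (hH i l).mul_continuousOn (by rw [Set.uIcc_of_le hαβ]; exact hF l j))).congr
    fun r _ => by simp

end Primitive

/-! ### Linear differential equations with integrable coefficients -/

/-- Powers of the indefinite integral `L` of `l`: `L ^ (p + 1)` is the integral of
`(p + 1) l L ^ p`. This gives the factorials in the bounds for the Picard iterates. -/
theorem primitive_pow {α β : ℝ} (hαβ : α ≤ β) {l : ℝ → ℝ}
    (hl : IntervalIntegrable l volume α β) (p : ℕ) :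
    IntervalIntegrable (fun r => l r * (∫ q in α..r, l q) ^ p) volume α β ∧
    ∀ s ∈ Set.Icc α β, (∫ q in α..s, l q) ^ (p + 1) =
      ∫ r in α..s, ((p + 1 : ℕ) : ℝ) * (l r * (∫ q in α..r, l q) ^ p) := by
  induction p with
  | zero => simp [hl]
  | succ p ih =>
    have h := primitive_mul hαβ (f := fun s => (∫ q in α..s, l q) ^ (p + 1))
      (g := fun s => ∫ q in α..s, l q) (ih.1.const_mul ((p + 1 : ℕ) : ℝ))
      (fun s hs => by simp only [intervalIntegral.integral_same]; rw [ih.2 s hs]; simp) hl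
      (fun s hs => by simp)
    have e : ∀ r, ((p + 1 : ℕ) : ℝ) * (l r * (∫ q in α..r, l q) ^ p) * (∫ q in α..r, l q) +
        (∫ q in α..r, l q) ^ (p + 1) * l r =
        ((p + 1 + 1 : ℕ) : ℝ) * (l r * (∫ q in α..r, l q) ^ (p + 1)) := by
      intro r; push_cast; ring
    simp only [e] at h
    constructor
    · refine (h.1.const_mul (((p + 1 + 1 : ℕ) : ℝ)⁻¹)).congr fun r _ => ?_
      have : ((p + 1 + 1 : ℕ) : ℝ) ≠ 0 := by positivity
      rw [inv_mul_cancel_left₀ this]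
    · intro s hs
      have := h.2 s hs
      simp only [intervalIntegral.integral_same, mul_zero, zero_add] at this
      rw [pow_succ, this]

/-- A linear differential equation with integrable coefficients has a solution in the sense of
Carathéodory with any given initial value; it is the sum of the Picard iterates. -/
theorem exists_linear_solution {n k : Type*} [Fintype n] [Fintype k] {α β : ℝ} (hαβ : α ≤ β)
    {H : ℝ → Matrix n n ℝ} (hH : ∀ i j, IntervalIntegrable (fun r => H r i j) volume α β)
    (F₀ : Matrix n k ℝ) :
    ∃ F : ℝ → Matrix n k ℝ, F α = F₀ ∧ IsPrimitiveOn α β F (fun r => H r * F r) := by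
  set l : ℝ → ℝ := fun r => ∑ i, ∑ j, |H r i j| with hldef
  have hl : IntervalIntegrable l volume α β := by
    refine (IntervalIntegrable.sum Finset.univ fun i _ =>
      IntervalIntegrable.sum Finset.univ fun j _ => (hH i j).abs).congr fun r _ => ?_
    simp [hldef]
  have hl0 : ∀ r, 0 ≤ l r := fun r => by positivity
  set L : ℝ → ℝ := fun s => ∫ q in α..s, l q with hLdef
  have hL0 : ∀ s, α ≤ s → 0 ≤ L s := fun s hs =>
    intervalIntegral.integral_nonneg hs fun r _ => hl0 r
  have hLmono : ∀ s ∈ Set.Icc α β, L s ≤ L β := fun s hs =>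
    intervalIntegral.integral_mono_interval le_rfl hs.1 hs.2
      (Eventually.of_forall hl0) hl
  set c : ℝ := ∑ i, ∑ j, |F₀ i j| with hc
  have hc0 : 0 ≤ c := by positivity
  -- The Picard increments `x (p + 1) s = ∫ H x p`, which satisfy `|x p s| ≤ c L(s) ^ p / p!`.
  let x : ℕ → ℝ → Matrix n k ℝ := fun p => Nat.rec (fun _ => F₀)
    (fun _ y s => Matrix.of fun i j => ∫ r in α..s, (H r * y r) i j) p
  have hx0 : ∀ s, x 0 s = F₀ := fun s => rfl
  have hxs : ∀ p s i j, x (p + 1) s i j = ∫ r in α..s, (H r * x p r) i j := fun p s i j => rfl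
  have hHl : ∀ (Y : Matrix n k ℝ) (B : ℝ) (r : ℝ), (∀ i j, |Y i j| ≤ B) →
      ∀ i j, |(H r * Y) i j| ≤ l r * B := by
    intro Y B r hY i j
    rw [Matrix.mul_apply]
    refine (Finset.abs_sum_le_sum_abs _ _).trans ?_
    have : ∑ q, |H r i q| ≤ l r :=
      Finset.single_le_sum (f := fun i => ∑ q, |H r i q|) (fun i _ => by positivity)
        (Finset.mem_univ i)
    have hB : 0 ≤ B := (abs_nonneg _).trans (hY i j)
    calc ∑ q, |H r i q * Y q j| ≤ ∑ q, |H r i q| * B :=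
          Finset.sum_le_sum fun q _ => by
            rw [abs_mul]; exact mul_le_mul_of_nonneg_left (hY q j) (abs_nonneg _)
      _ = (∑ q, |H r i q|) * B := by rw [Finset.sum_mul]
      _ ≤ l r * B := mul_le_mul_of_nonneg_right this hB
  have hcont : ∀ p i j, ContinuousOn (fun s => x p s i j) (Set.Icc α β) := by
    intro p
    induction p with
    | zero => intro i j; exact continuousOn_const
    | succ p ih =>
      intro i j
      refine primitive_continuousOn hαβ (intervalIntegrable_mul_right hαβ ih hH i j) fun s hs => ?_
      rw [hxs, hxs]; simp
  have hHx : ∀ p i j, IntervalIntegrable (fun r => (H r * x p r) i j) volume α β := fun p =>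
    intervalIntegrable_mul_right hαβ (hcont p) hH
  have hbound : ∀ p, ∀ s ∈ Set.Icc α β, ∀ i j, |x p s i j| ≤ c * (L s ^ p / p.factorial) := by
    intro p
    induction p with
    | zero =>
      intro s hs i j
      simp only [hx0, pow_zero, Nat.factorial_zero, Nat.cast_one, div_one, mul_one]
      exact (Finset.single_le_sum (f := fun j => |F₀ i j|) (fun j _ => abs_nonneg _)
        (Finset.mem_univ j)).trans (Finset.single_le_sum (f := fun i => ∑ j, |F₀ i j|)
        (fun i _ => by positivity) (Finset.mem_univ i))
    | succ p ih =>
      intro s hs i j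
      obtain ⟨hpi, hp⟩ := primitive_pow hαβ hl p
      rw [hxs]
      have hbd : IntervalIntegrable (fun r => c / p.factorial * (l r * L r ^ p)) volume α s :=
        (intervalIntegrable_mono hpi le_rfl hs.1 hs.2).const_mul _
      calc |∫ r in α..s, (H r * x p r) i j|
          ≤ ∫ r in α..s, c / p.factorial * (l r * L r ^ p) := by
            rw [← Real.norm_eq_abs]
            refine intervalIntegral.norm_integral_le_of_norm_le hs.1 ?_ hbd
            refine Eventually.of_forall fun r hr => ?_
            have hr' : r ∈ Set.Icc α β := ⟨hr.1.le, hr.2.trans hs.2⟩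
            refine (hHl _ _ r (ih r hr') i j).trans (le_of_eq ?_)
            ring
        _ = c * (L s ^ (p + 1) / (p + 1).factorial) := by
            have h2 := hp s hs
            rw [intervalIntegral.integral_const_mul] at h2 ⊢
            change L s ^ (p + 1) = _ at h2
            rw [h2, Nat.factorial_succ]
            push_cast
            have : (p.factorial : ℝ) ≠ 0 := by positivity
            have : (p + 1 : ℝ) ≠ 0 := by positivity
            field_simp
            rfl
  have hbound' : ∀ p, ∀ s ∈ Set.Icc α β, ∀ i j, |x p s i j| ≤ c * (L β ^ p / p.factorial) := by
    intro p s hs i j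
    refine (hbound p s hs i j).trans ?_
    gcongr
    · exact hL0 s hs.1
    · exact hLmono s hs
  have hsummable : Summable fun p : ℕ => c * (L β ^ p / p.factorial) :=
    (Real.summable_pow_div_factorial _).mul_left c
  have hxsum : ∀ s ∈ Set.Icc α β, ∀ i j, Summable fun p => x p s i j := fun s hs i j =>
    Summable.of_norm_bounded hsummable fun p => hbound' p s hs i j
  let F : ℝ → Matrix n k ℝ := fun s => Matrix.of fun i j => ∑' p, x p s i j
  have hFcont : ∀ i j, ContinuousOn (fun s => F s i j) (Set.Icc α β) := fun i j =>
    continuousOn_tsum (fun p => hcont p i j) hsummable fun p s hs => hbound' p s hs i j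
  have hFeq : ∀ s ∈ Set.Icc α β, ∀ i j, F s i j = F₀ i j + ∫ r in α..s, (H r * F r) i j := by
    intro s hs i j
    have h1 : HasSum (fun p => ∫ r in α..s, (H r * x p r) i j) (∫ r in α..s, (H r * F r) i j) := by
      refine intervalIntegral.hasSum_integral_of_dominated_convergence
        (fun p r => l r * (c * (L β ^ p / p.factorial))) (fun p => ?_) (fun p => ?_) ?_ ?_ ?_
      · exact (intervalIntegrable_mono (hHx p i j) le_rfl hs.1 hs.2).def'.aestronglyMeasurable
      · refine Eventually.of_forall fun r hr => ?_
        rw [Set.uIoc_of_le hs.1] at hr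
        exact hHl _ _ r (hbound' p r ⟨hr.1.le, hr.2.trans hs.2⟩) i j
      · exact Eventually.of_forall fun r hr => hsummable.mul_left _
      · simp only [tsum_mul_left]
        exact (intervalIntegrable_mono hl le_rfl hs.1 hs.2).mul_const _
      · refine Eventually.of_forall fun r hr => ?_
        rw [Set.uIoc_of_le hs.1] at hr
        simp only [Matrix.mul_apply]
        exact hasSum_sum fun q _ => ((hxsum r ⟨hr.1.le, hr.2.trans hs.2⟩ q j).hasSum).mul_left _
    have h2 := (hxsum s hs i j).hasSum
    have h3 : HasSum (fun p => x p s i j) (F₀ i j + ∫ r in α..s, (H r * F r) i j) := by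
      rw [← hasSum_nat_add_iff' 1]
      simpa [hx0, hxs] using h1
    exact h2.unique h3
  have hFα : F α = F₀ := by
    ext i j
    simpa using hFeq α ⟨le_rfl, hαβ⟩ i j
  refine ⟨F, hFα, fun i j => intervalIntegrable_mul_right hαβ hFcont hH i j, fun s hs i j => ?_⟩
  rw [hFα, hFeq s hs i j]

/-- The fundamental matrix `Φ` of `x' = A x` together with its inverse `Ψ`, which solves the
adjoint equation. -/
theorem exists_fundamental {n : Type*} [Fintype n] [DecidableEq n] {α β : ℝ} (hαβ : α ≤ β)
    {A : ℝ → Matrix n n ℝ} (hA : ∀ i j, IntervalIntegrable (fun r => A r i j) volume α β) :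
    ∃ Φ Ψ : ℝ → Matrix n n ℝ, Φ α = 1 ∧ Ψ α = 1 ∧
      IsPrimitiveOn α β Φ (fun r => A r * Φ r) ∧ IsPrimitiveOn α β Ψ (fun r => -(Ψ r * A r)) ∧
      ∀ s ∈ Set.Icc α β, Ψ s * Φ s = 1 := by
  obtain ⟨Φ, hΦ0, hΦ⟩ := exists_linear_solution hαβ hA (1 : Matrix n n ℝ)
  obtain ⟨Z, hZ0, hZ⟩ := exists_linear_solution hαβ (H := fun r => -(A r)ᵀ)
    (fun i j => (hA j i).neg) (1 : Matrix n n ℝ)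
  have hΨ : IsPrimitiveOn α β (fun r => (Z r)ᵀ) (fun r => -((Z r)ᵀ * A r)) :=
    hZ.transpose.congr (fun _ _ => rfl) (fun r _ => by simp [Matrix.transpose_mul]) hαβ
  refine ⟨Φ, fun r => (Z r)ᵀ, hΦ0, by simp [hZ0], hΦ, hΨ, fun s hs => ?_⟩
  have := (hΨ.mul hΦ hαβ).eq_of_zero (fun r _ => by noncomm_ring) s hs
  simpa [hΦ0, hZ0] using this

/-- The inverse of an absolutely continuous family of invertible matrices is absolutely
continuous, with the usual derivative. The candidate is the solution of the linear equation
`Z' = -Z W' W⁻¹`. -/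
theorem IsPrimitiveOn.inv {n : Type*} [Fintype n] [DecidableEq n] {α β : ℝ} (hαβ : α ≤ β)
    {W W' : ℝ → Matrix n n ℝ} (hW : IsPrimitiveOn α β W W')
    (hdet : ∀ s ∈ Set.Icc α β, IsUnit (W s).det) :
    IsPrimitiveOn α β (fun s => (W s)⁻¹) (fun s => -((W s)⁻¹ * W' s * (W s)⁻¹)) := by
  have hinv : ∀ i j, ContinuousOn (fun s => (W s)⁻¹ i j) (Set.Icc α β) := by
    have hWc : ContinuousOn W (Set.Icc α β) :=
      continuousOn_pi.2 fun i => continuousOn_pi.2 fun j => hW.continuousOn hαβ i j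
    have hdetc : ContinuousOn (fun s => (W s).det) (Set.Icc α β) := by
      have : Continuous fun M : Matrix n n ℝ => M.det := continuous_id.matrix_det
      exact this.comp_continuousOn hWc
    have hadj : ContinuousOn (fun s => (W s).adjugate) (Set.Icc α β) := by
      have : Continuous fun M : Matrix n n ℝ => M.adjugate := continuous_id.matrix_adjugate
      exact this.comp_continuousOn hWc
    intro i j
    simp only [Matrix.inv_def, Ring.inverse_eq_inv', Matrix.smul_apply, smul_eq_mul]
    refine (hdetc.inv₀ fun s hs => (hdet s hs).ne_zero).mul ?_
    exact continuousOn_pi.1 (continuousOn_pi.1 hadj i) j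
  obtain ⟨Z, hZ0, hZ⟩ := exists_linear_solution hαβ (H := fun r => -(W' r * (W r)⁻¹)ᵀ)
    (fun i j => (intervalIntegrable_mul_right hαβ hinv hW.integrable j i).neg) ((W α)⁻¹)ᵀ
  have hZW : ∀ s ∈ Set.Icc α β, (Z s)ᵀ * W s = 1 := by
    intro s hs
    have hα : α ∈ Set.Icc α β := ⟨le_rfl, hαβ⟩
    have := (hZ.transpose.mul hW hαβ).eq_of_zero (fun r hr => ?_) s hs
    · rw [this, hZ0, Matrix.transpose_transpose, Matrix.nonsing_inv_mul _ (hdet α hα)]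
    · simp only [Matrix.transpose_mul, Matrix.transpose_neg, Matrix.transpose_transpose]
      have := Matrix.nonsing_inv_mul _ (hdet r hr)
      simp [Matrix.mul_assoc, this]
  have hZinv : ∀ s ∈ Set.Icc α β, (Z s)ᵀ = (W s)⁻¹ := fun s hs =>
    (Matrix.inv_eq_left_inv (hZW s hs)).symm
  refine hZ.transpose.congr hZinv (fun s hs => ?_) hαβ
  rw [← hZinv s hs]
  simp [Matrix.transpose_mul, Matrix.mul_assoc, hZinv s hs]

/-! ### The Hamiltonian system of the Riccati equation -/

section

variable {n : Type*} [Fintype n] {α β : ℝ} {a B h : ℝ → Matrix n n ℝ}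

/-- `(U, W)` solves on `[α, β]` the linear Hamiltonian system `U' = a U + B W`,
`W' = h U - aᵀ W` attached to a Riccati equation. -/
structure IsHamiltonianOn (α β : ℝ) (a B h : ℝ → Matrix n n ℝ) (U W : ℝ → Matrix n n ℝ) : Prop where
  fst : IsPrimitiveOn α β U (fun r => a r * U r + B r * W r)
  snd : IsPrimitiveOn α β W (fun r => h r * U r - (a r)ᵀ * W r)

/-- The Hamiltonian system is a linear equation for the block column `(U, W)`. -/
theorem exists_isHamiltonianOn (hαβ : α ≤ β)
    (ha : ∀ i j, IntervalIntegrable (fun r => a r i j) volume α β)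
    (hB : ∀ i j, IntervalIntegrable (fun r => B r i j) volume α β)
    (hh : ∀ i j, IntervalIntegrable (fun r => h r i j) volume α β) (U₀ W₀ : Matrix n n ℝ) :
    ∃ U W : ℝ → Matrix n n ℝ, U α = U₀ ∧ W α = W₀ ∧ IsHamiltonianOn α β a B h U W := by
  obtain ⟨F, hF0, hF⟩ := exists_linear_solution hαβ
    (H := fun r => Matrix.fromBlocks (a r) (B r) (h r) (-(a r)ᵀ))
    (by
      rintro (i | i) (j | j)
      · exact ha i j
      · exact hB i j
      · exact hh i j
      · exact (ha j i).neg) (Matrix.fromRows U₀ W₀)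
  have hrows : ∀ r, F r = Matrix.fromRows (F r).toRows₁ (F r).toRows₂ := fun r =>
    (Matrix.fromRows_toRows _).symm
  have hval : ∀ r, Matrix.fromBlocks (a r) (B r) (h r) (-(a r)ᵀ) * F r =
      Matrix.fromRows (a r * (F r).toRows₁ + B r * (F r).toRows₂)
        (h r * (F r).toRows₁ - (a r)ᵀ * (F r).toRows₂) := by
    intro r
    conv_lhs => rw [hrows r]
    rw [Matrix.fromBlocks_mul_fromRows, Matrix.neg_mul, ← sub_eq_add_neg]
  simp only [hval] at hF
  refine ⟨fun r => (F r).toRows₁, fun r => (F r).toRows₂, by simp [hF0], by simp [hF0],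
    ⟨fun i j => hF.integrable (.inl i) j, fun s hs i j => hF.eq s hs (.inl i) j⟩,
    ⟨fun i j => hF.integrable (.inr i) j, fun s hs i j => hF.eq s hs (.inr i) j⟩⟩

namespace IsHamiltonianOn

variable {U W P R : ℝ → Matrix n n ℝ}

theorem mono (hUW : IsHamiltonianOn α β a B h U W) {α' β' : ℝ} (hα : α ≤ α') (hβ : β' ≤ β)
    (hαβ : α' ≤ β') : IsHamiltonianOn α' β' a B h U W :=
  ⟨hUW.fst.mono hα hβ hαβ, hUW.snd.mono hα hβ hαβ⟩

/-- The symplectic form of two solutions of the Hamiltonian system is constant. -/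
theorem bracket (hUW : IsHamiltonianOn α β a B h U W) (hPR : IsHamiltonianOn α β a B h P R)
    (hαβ : α ≤ β) (hB : ∀ r, (B r)ᵀ = B r) (hh : ∀ r, (h r)ᵀ = h r) :
    ∀ s ∈ Set.Icc α β, (U s)ᵀ * R s - (W s)ᵀ * P s = (U α)ᵀ * R α - (W α)ᵀ * P α := by
  refine ((hUW.fst.transpose.mul hPR.snd hαβ).sub
    (hUW.snd.transpose.mul hPR.fst hαβ)).eq_of_zero fun r _ => ?_
  simp only [Matrix.transpose_add, Matrix.transpose_sub, Matrix.transpose_mul, hB, hh,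
    Matrix.transpose_transpose]
  noncomm_ring

/-- If `p` solves the Riccati equation, then `W - p U` solves the equation which is adjoint to
`x' = (a + B p) x`; hence its product with the fundamental matrix of the latter is constant. -/
theorem transpose_fundamental_mul (hUW : IsHamiltonianOn α β a B h U W) (hαβ : α ≤ β)
    (hB : ∀ r, (B r)ᵀ = B r) {p Φ : ℝ → Matrix n n ℝ}
    (hpt : ∀ r ∈ Set.Icc α β, (p r)ᵀ = p r)
    (hp : IsPrimitiveOn α β p
      (fun r => -(p r * B r * p r) - (a r)ᵀ * p r - p r * a r + h r))
    (hΦ : IsPrimitiveOn α β Φ (fun r => (a r + B r * p r) * Φ r)) :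
    ∀ s ∈ Set.Icc α β, (Φ s)ᵀ * (W s - p s * U s) = (Φ α)ᵀ * (W α - p α * U α) := by
  refine (hΦ.transpose.mul (hUW.snd.sub (hp.mul hUW.fst hαβ)) hαβ).eq_of_zero fun r hr => ?_
  simp only [Matrix.transpose_add, Matrix.transpose_mul, hB, hpt r hr]
  noncomm_ring

end IsHamiltonianOn

/-- The covariance `Φ(s) S(s) Φ(u)ᵀ` of the linear equation with drift `a + B p`, where `p` is the
Riccati solution with horizon `v`, in terms of solutions of the Hamiltonian system which do not
depend on the horizon. -/
theorem fundamental_mul_eq_hamiltonian [DecidableEq n] {v : ℝ} (hv : 0 ≤ v) (hB : ∀ r, (B r)ᵀ = B r)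
    {p Φ Ψ S U W : ℝ → Matrix n n ℝ} {S₀ : Matrix n n ℝ}
    (hpt : ∀ r ∈ Set.Icc 0 v, (p r)ᵀ = p r) (hpv : p v = 0)
    (hp : IsPrimitiveOn 0 v p
      (fun r => -(p r * B r * p r) - (a r)ᵀ * p r - p r * a r + h r))
    (hΦ0 : Φ 0 = 1) (hΨ0 : Ψ 0 = 1)
    (hΦ : IsPrimitiveOn 0 v Φ (fun r => (a r + B r * p r) * Φ r))
    (hΨ : IsPrimitiveOn 0 v Ψ (fun r => -(Ψ r * (a r + B r * p r))))
    (hΨΦ : ∀ s ∈ Set.Icc 0 v, Ψ s * Φ s = 1)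
    (hS : IsPrimitiveOn 0 v S (fun r => Ψ r * B r * (Ψ r)ᵀ))
    (hS0 : S 0 * (1 - p 0 * S₀) = S₀) (hdet : IsUnit (1 - p 0 * S₀).det)
    (hU0 : U 0 = S₀) (hW0 : W 0 = 1) (hUW : IsHamiltonianOn 0 v a B h U W) :
    IsUnit (W v).det ∧ ∀ s u, 0 ≤ s → 0 ≤ u → s ≤ v → u ≤ v → ∀ P R : ℝ → Matrix n n ℝ,
      P u = 0 → R u = 1 → IsHamiltonianOn u v a B h P R →
      Φ s * S s * (Φ u)ᵀ = U s * (W v)⁻¹ * R v := by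
  have hvm : v ∈ Set.Icc 0 v := ⟨hv, le_rfl⟩
  set G := 1 - p 0 * S₀ with hG
  have hD : ∀ s ∈ Set.Icc 0 v, (Φ s)ᵀ * (W s - p s * U s) = G := by
    intro s hs
    rw [hUW.transpose_fundamental_mul hv hB hpt hp hΦ s hs, hΦ0, hU0, hW0]
    simp [hG]
  have hGW : (Φ v)ᵀ * W v = G := by simpa [hpv] using hD v hvm
  have hWu : IsUnit (W v).det := by
    rw [← hGW, Matrix.det_mul] at hdet
    exact isUnit_of_mul_isUnit_right hdet
  refine ⟨hWu, fun s u hs0 hu0 hsv huv P R hP hR hPR => ?_⟩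
  have hΨt : ∀ s ∈ Set.Icc 0 v, (Ψ s)ᵀ * (Φ s)ᵀ = 1 := by
    intro s hs
    rw [← Matrix.transpose_mul, mul_eq_one_comm.1 (hΨΦ s hs), Matrix.transpose_one]
  have hD' : ∀ s ∈ Set.Icc 0 v, W s - p s * U s = (Ψ s)ᵀ * G := by
    intro s hs
    rw [← hD s hs, ← Matrix.mul_assoc, hΨt s hs, Matrix.one_mul]
  -- Both sides have the derivative `Ψ B Ψᵀ G`, and `hS0` says that they agree at time `0`.
  have hΨU : ∀ s ∈ Set.Icc 0 v, Ψ s * U s = S s * G := by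
    intro s hs
    have := ((hΨ.mul hUW.fst hv).sub (hS.mul (IsPrimitiveOn.const G) hv)).eq_of_zero
      (fun r hr => ?_) s hs
    · rw [hΨ0, hU0, hS0, Matrix.one_mul, sub_self] at this
      exact sub_eq_zero.1 this
    · simp only [Pi.zero_apply]
      have e : Ψ r * B r * (Ψ r)ᵀ * G = Ψ r * B r * (W r - p r * U r) := by
        rw [hD' r hr, Matrix.mul_assoc _ _ G]
      rw [e]
      noncomm_ring
  have hU : U s = Φ s * S s * G := by
    rw [Matrix.mul_assoc, ← hΨU s ⟨hs0, hsv⟩, ← Matrix.mul_assoc,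
      mul_eq_one_comm.1 (hΨΦ s ⟨hs0, hsv⟩), Matrix.one_mul]
  have hRv : (Φ u)ᵀ = (Φ v)ᵀ * R v := by
    have := hPR.transpose_fundamental_mul huv hB
      (fun r hr => hpt r ⟨hu0.trans hr.1, hr.2⟩) (hp.mono hu0 le_rfl huv) (hΦ.mono hu0 le_rfl huv)
      v ⟨huv, le_rfl⟩
    simpa [hP, hR, hpv] using this.symm
  have hΦv : G * (W v)⁻¹ = (Φ v)ᵀ := by
    rw [← hGW, Matrix.mul_assoc, Matrix.mul_nonsing_inv _ hWu, Matrix.mul_one]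
  rw [hU, Matrix.mul_assoc _ G, hΦv, Matrix.mul_assoc _ _ (R v), hRv]

/-- A family of matrices `K v s u` which is given by the solutions of the Hamiltonian system has
the derivative `-K(v, v, s)ᵀ h(v) K(v, v, u)` with respect to the horizon `v`. -/
theorem isPrimitiveOn_horizon [DecidableEq n] {T : ℝ} (hB : ∀ r, (B r)ᵀ = B r)
    (hh : ∀ r, (h r)ᵀ = h r) (hai : ∀ i j, IntervalIntegrable (fun r => a r i j) volume 0 T)
    (hBi : ∀ i j, IntervalIntegrable (fun r => B r i j) volume 0 T)
    (hhi : ∀ i j, IntervalIntegrable (fun r => h r i j) volume 0 T)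
    {S₀ : Matrix n n ℝ} (hS₀ : S₀ᵀ = S₀) {U W : ℝ → Matrix n n ℝ} (hU0 : U 0 = S₀) (hW0 : W 0 = 1)
    (hUW : IsHamiltonianOn 0 T a B h U W) (hdet : ∀ v ∈ Set.Icc 0 T, IsUnit (W v).det)
    (K : ℝ → ℝ → ℝ → Matrix n n ℝ) (hKt : ∀ v s u, (K v s u)ᵀ = K v u s)
    (hK : ∀ v s u, 0 ≤ s → s ≤ u → u ≤ v → v ≤ T → ∀ P R : ℝ → Matrix n n ℝ,
      P u = 0 → R u = 1 → IsHamiltonianOn u v a B h P R → K v s u = U s * (W v)⁻¹ * R v)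
    {s u : ℝ} (hs : 0 ≤ s) (hsu : s ≤ u) (huT : u ≤ T) :
    IsPrimitiveOn u T (fun v => K v s u) (fun v => -((K v v s)ᵀ * h v * K v v u)) := by
  have hu := hs.trans hsu
  have hsub : ∀ {f : ℝ → ℝ}, IntervalIntegrable f volume 0 T → IntervalIntegrable f volume u T :=
    fun hf => intervalIntegrable_mono hf hu huT le_rfl
  obtain ⟨P, R, hP, hR, hPR⟩ := exists_isHamiltonianOn (a := a) (B := B) (h := h) huT
    (fun i j => hsub (hai i j)) (fun i j => hsub (hBi i j)) (fun i j => hsub (hhi i j)) 0 1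
  have hdet' : ∀ v ∈ Set.Icc u T, IsUnit (W v).det := fun v hv => hdet v ⟨hu.trans hv.1, hv.2⟩
  have hUWu := hUW.mono hu le_rfl huT
  have hE := (IsPrimitiveOn.const (α := u) (β := T) (U s)).mul
    (((hUWu.snd.inv huT hdet').mul hPR.snd huT)) huT
  refine hE.congr (fun v hv => ?_) (fun v hv => ?_) huT
  · rw [hK v s u hs hsu hv.1 hv.2 P R hP hR (hPR.mono le_rfl hv.2 hv.1), Matrix.mul_assoc]
  · have hv0 := hu.trans hv.1
    -- With second time equal to the horizon, the second Hamiltonian solution does not intervene.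
    have hKv : ∀ x, 0 ≤ x → x ≤ v → K v x v = U x * (W v)⁻¹ := by
      intro x hx hxv
      rw [hK v x v hx hxv le_rfl hv.2 (fun _ => 0) (fun _ => 1) rfl rfl]
      · simp
      · refine ⟨⟨fun i j => by simp, fun q hq i j => ?_⟩,
          ⟨fun i j => by simp, fun q hq i j => ?_⟩⟩ <;>
        · obtain rfl : q = v := le_antisymm hq.2 hq.1
          simp
    have h1 : (K v v s)ᵀ = U s * (W v)⁻¹ := by rw [hKt, hKv s hs (hsu.trans hv.1)]
    have hWi := Matrix.nonsing_inv_mul _ (hdet' v hv)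
    have hWi' := Matrix.mul_nonsing_inv _ (hdet' v hv)
    have hWt : ((W v)ᵀ)⁻¹ * (W v)ᵀ = 1 := by
      rw [← Matrix.transpose_nonsing_inv, ← Matrix.transpose_mul, hWi', Matrix.transpose_one]
    -- `U W⁻¹` is symmetric, because the bracket of `(U, W)` with itself vanishes.
    have hsymm : ((W v)ᵀ)⁻¹ * (U v)ᵀ = U v * (W v)⁻¹ := by
      have := hUW.bracket hUW (hv0.trans hv.2) hB hh v ⟨hv0, hv.2⟩
      rw [hU0, hW0, hS₀, Matrix.transpose_one, Matrix.mul_one, Matrix.one_mul, sub_self,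
        sub_eq_zero] at this
      calc ((W v)ᵀ)⁻¹ * (U v)ᵀ = ((W v)ᵀ)⁻¹ * ((U v)ᵀ * W v) * (W v)⁻¹ := by
            rw [Matrix.mul_assoc, Matrix.mul_assoc (U v)ᵀ, hWi', Matrix.mul_one]
        _ = U v * (W v)⁻¹ := by
            rw [this, ← Matrix.mul_assoc, hWt, Matrix.one_mul]
    have h2 : K v v u = U v * (W v)⁻¹ * R v - P v := by
      rw [← hKt, hKv u hu hv.1, Matrix.transpose_mul, Matrix.transpose_nonsing_inv]
      have := hUWu.bracket hPR huT hB hh v hv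
      rw [hP, hR, Matrix.mul_one, Matrix.mul_zero, sub_zero] at this
      rw [← this, Matrix.mul_sub, ← Matrix.mul_assoc, ← Matrix.mul_assoc, hsymm, hWt,
        Matrix.one_mul]
    rw [h1, h2]
    simp only [Pi.zero_apply, Matrix.zero_mul, zero_add]
    have e : (W v)⁻¹ * (h v * U v - (a v)ᵀ * W v) * (W v)⁻¹ * R v =
        (W v)⁻¹ * h v * U v * (W v)⁻¹ * R v - (W v)⁻¹ * (a v)ᵀ * R v := by
      have : (W v)⁻¹ * (a v)ᵀ * W v * (W v)⁻¹ = (W v)⁻¹ * (a v)ᵀ := by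
        rw [Matrix.mul_assoc _ (W v), hWi', Matrix.mul_one]
      rw [Matrix.mul_sub, Matrix.sub_mul, Matrix.sub_mul, ← Matrix.mul_assoc, ← Matrix.mul_assoc,
        this]
    rw [Matrix.neg_mul, e]
    noncomm_ring

end

/-! ### Wiener integrals -/

section L2

variable {Ω : Type*} [MeasurableSpace Ω] {μ : Measure Ω}

theorem tendsto_integral_mul_of_eLpNorm {X Y : ℕ → Ω → ℝ} {X' Y' : Ω → ℝ}
    (hX : ∀ n, MemLp (X n) 2 μ) (hY : ∀ n, MemLp (Y n) 2 μ) (hX' : MemLp X' 2 μ)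
    (hY' : MemLp Y' 2 μ)
    (hXlim : Tendsto (fun n => eLpNorm (fun ω => X n ω - X' ω) 2 μ) atTop (𝓝 0))
    (hYlim : Tendsto (fun n => eLpNorm (fun ω => Y n ω - Y' ω) 2 μ) atTop (𝓝 0)) :
    Tendsto (fun n => ∫ ω, X n ω * Y n ω ∂μ) atTop (𝓝 (∫ ω, X' ω * Y' ω ∂μ)) := by
  have hinner : ∀ {f g : Ω → ℝ} (hf : MemLp f 2 μ) (hg : MemLp g 2 μ),
      inner ℝ (hf.toLp f) (hg.toLp g) = ∫ ω, f ω * g ω ∂μ := by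
    intro f g hf hg
    rw [L2.inner_def]
    refine integral_congr_ae ?_
    filter_upwards [hf.coeFn_toLp, hg.coeFn_toLp] with ω h1 h2
    simp [h1, h2, mul_comm]
  have h1 := (Lp.tendsto_Lp_iff_tendsto_eLpNorm'' X hX X' hX').2 hXlim
  have h2 := (Lp.tendsto_Lp_iff_tendsto_eLpNorm'' Y hY Y' hY').2 hYlim
  have := h1.inner (𝕜 := ℝ) h2
  simpa only [hinner] using this

theorem tendsto_covariance_of_eLpNorm [IsProbabilityMeasure μ] {X Y : ℕ → Ω → ℝ} {X' Y' : Ω → ℝ}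
    (hX : ∀ n, MemLp (X n) 2 μ) (hY : ∀ n, MemLp (Y n) 2 μ) (hX' : MemLp X' 2 μ)
    (hY' : MemLp Y' 2 μ)
    (hXlim : Tendsto (fun n => eLpNorm (fun ω => X n ω - X' ω) 2 μ) atTop (𝓝 0))
    (hYlim : Tendsto (fun n => eLpNorm (fun ω => Y n ω - Y' ω) 2 μ) atTop (𝓝 0)) :
    Tendsto (fun n => cov[X n, Y n; μ]) atTop (𝓝 cov[X', Y'; μ]) := by
  have hone : MemLp (fun _ : Ω => (1 : ℝ)) 2 μ := memLp_const 1
  have hmean : ∀ {Z : ℕ → Ω → ℝ} {Z' : Ω → ℝ}, (∀ n, MemLp (Z n) 2 μ) → MemLp Z' 2 μ →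
      Tendsto (fun n => eLpNorm (fun ω => Z n ω - Z' ω) 2 μ) atTop (𝓝 0) →
      Tendsto (fun n => ∫ ω, Z n ω ∂μ) atTop (𝓝 (∫ ω, Z' ω ∂μ)) := by
    intro Z Z' hZ hZ' hlim
    simpa using tendsto_integral_mul_of_eLpNorm hZ (fun _ => hone) hZ' hone hlim (by simp)
  have h := (tendsto_integral_mul_of_eLpNorm hX hY hX' hY' hXlim hYlim).sub
    ((hmean hX hX' hXlim).mul (hmean hY hY' hYlim))
  rw [covariance_eq_sub hX' hY']
  refine h.congr fun n => ?_
  rw [covariance_eq_sub (hX n) (hY n)]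
  rfl

theorem memLp_of_tendsto_eLpNorm {X : ℕ → Ω → ℝ} {X' : Ω → ℝ} (hX : ∀ n, MemLp (X n) 2 μ)
    (hX' : AEStronglyMeasurable X' μ)
    (hlim : Tendsto (fun n => eLpNorm (fun ω => X n ω - X' ω) 2 μ) atTop (𝓝 0)) :
    MemLp X' 2 μ := by
  obtain ⟨n, hn⟩ := (hlim.eventually_lt_const zero_lt_one).exists
  have h : MemLp (fun ω => X n ω - X' ω) 2 μ :=
    ⟨(hX n).aestronglyMeasurable.sub hX', hn.trans ENNReal.one_lt_top⟩
  have := (hX n).sub h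
  refine this.ae_eq (Eventually.of_forall fun ω => ?_)
  simp

end L2

section Wiener

theorem StepFun.memLp_eval (g : StepFun) : MemLp g.eval 2 volume := by
  have := memLp_finsetSum (μ := volume) (p := 2) (Finset.univ : Finset (Fin g.size))
    (f := fun k => (Set.Ioc (g.left k : ℝ) (g.right k)).indicator fun _ => g.coeff k)
    (fun k _ => memLp_indicator_const 2 measurableSet_Ioc _ (Or.inr (by simp)))
  exact this

variable {Ω : Type*} [MeasurableSpace Ω] {P : Measure Ω}

theorem StepFun.memLp_integral (g : StepFun) {B : ℝ≥0 → Ω → ℝ} (hB : ∀ t, MemLp (B t) 2 P) :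
    MemLp (g.integral B) 2 P := by
  have := memLp_finsetSum (Finset.univ : Finset (Fin g.size))
    (f := fun k ω => g.coeff k * (B (g.right k) ω - B (g.left k) ω))
    (fun k _ => ((hB _).sub (hB _)).const_mul _)
  exact this

/-- The covariance of two Brownian increments is the length of the overlap of the time
intervals. -/
theorem covariance_increment [IsProbabilityMeasure P] {B : ℝ≥0 → Ω → ℝ} (hB : IsBrownianReal B P)
    {l r l' r' : ℝ≥0} (h : l ≤ r) (h' : l' ≤ r') :
    cov[fun ω => B r ω - B l ω, fun ω => B r' ω - B l' ω; P] =
      volume.real (Set.Ioc (l : ℝ) r ∩ Set.Ioc (l' : ℝ) r') := by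
  have hL : ∀ t, MemLp (B t) 2 P := fun t =>
    (hB.toIsPreBrownianReal.hasLaw_eval t).hasGaussianLaw.memLp_two
  rw [covariance_fun_sub_fun_sub (hL _) (hL _) (hL _) (hL _)]
  simp only [hB.toIsPreBrownianReal.covariance_fun_eval, Set.Ioc_inter_Ioc, Real.volume_real_Ioc]
  have h1 : (l : ℝ) ≤ r := h
  have h2 : (l' : ℝ) ≤ r' := h'
  push_cast
  simp only [min_def, max_def]
  split_ifs <;> linarith

theorem StepFun.covariance_integral [IsProbabilityMeasure P] {B : ℝ≥0 → Ω → ℝ}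
    (hB : IsBrownianReal B P) (g g' : StepFun) :
    cov[g.integral B, g'.integral B; P] = ∫ r, g.eval r * g'.eval r := by
  have hL : ∀ t, MemLp (B t) 2 P := fun t =>
    (hB.toIsPreBrownianReal.hasLaw_eval t).hasGaussianLaw.memLp_two
  have h1 : cov[g.integral B, g'.integral B; P] = ∑ k, ∑ k', g.coeff k * (g'.coeff k' *
      volume.real (Set.Ioc (g.left k : ℝ) (g.right k) ∩
        Set.Ioc (g'.left k' : ℝ) (g'.right k'))) := by
    have := covariance_fun_sum_fun_sum (μ := P)
      (X := fun k ω => g.coeff k * (B (g.right k) ω - B (g.left k) ω))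
      (Y := fun k ω => g'.coeff k * (B (g'.right k) ω - B (g'.left k) ω))
      (fun k => ((hL _).sub (hL _)).const_mul _) (fun k => ((hL _).sub (hL _)).const_mul _)
    refine this.trans (Finset.sum_congr rfl fun k _ => Finset.sum_congr rfl fun k' _ => ?_)
    rw [covariance_const_mul_left, covariance_const_mul_right,
      covariance_increment hB (g.left_le_right k) (g'.left_le_right k')]
  have h2 : ∀ r, g.eval r * g'.eval r = ∑ k, ∑ k', (Set.Ioc (g.left k : ℝ) (g.right k) ∩
        Set.Ioc (g'.left k' : ℝ) (g'.right k')).indicator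
        (fun _ => g.coeff k * g'.coeff k') r := by
    intro r
    simp only [StepFun.eval, Finset.sum_mul_sum]
    refine Finset.sum_congr rfl fun k _ => Finset.sum_congr rfl fun k' _ => ?_
    rw [Set.inter_indicator_mul]
  have hfin : ∀ k k', volume (Set.Ioc (g.left k : ℝ) (g.right k) ∩
        Set.Ioc (g'.left k' : ℝ) (g'.right k')) ≠ ∞ := fun k k' =>
    ((measure_mono Set.inter_subset_left).trans_lt measure_Ioc_lt_top).ne
  have hint : ∀ k k', Integrable ((Set.Ioc (g.left k : ℝ) (g.right k) ∩
        Set.Ioc (g'.left k' : ℝ) (g'.right k')).indicator (fun _ => g.coeff k * g'.coeff k'))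
        volume := fun k k' =>
    (integrable_indicator_iff (measurableSet_Ioc.inter measurableSet_Ioc)).2
      (integrableOn_const (hfin k k'))
  simp only [h2]
  rw [h1, integral_finsetSum _ fun k _ => integrable_finsetSum _ fun k' _ => hint k k']
  refine Finset.sum_congr rfl fun k _ => ?_
  rw [integral_finsetSum _ fun k' _ => hint k k']
  refine Finset.sum_congr rfl fun k' _ => ?_
  rw [integral_indicator_const _ (measurableSet_Ioc.inter measurableSet_Ioc), smul_eq_mul]
  ring

variable {m : ℕ} {V : Fin m → ℝ≥0 → Ω → ℝ}

theorem IsBrownianVec.memLp (hV : IsBrownianVec P V) (k : Fin m) (t : ℝ≥0) :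
    MemLp (V k t) 2 P :=
  ((hV.brownian k).toIsPreBrownianReal.hasLaw_eval t).hasGaussianLaw.memLp_two

theorem measurable_stepFun_integral (g : StepFun) :
    Measurable fun x : ℝ≥0 → ℝ => ∑ k, g.coeff k * (x (g.right k) - x (g.left k)) := by
  fun_prop

theorem IsBrownianVec.covariance_stepFun_integral [IsProbabilityMeasure P]
    (hV : IsBrownianVec P V) (g g' : Fin m → StepFun) :
    cov[fun ω => ∑ k, (g k).integral (V k) ω, fun ω => ∑ k, (g' k).integral (V k) ω; P] =
      ∑ k, ∫ r, (g k).eval r * (g' k).eval r := by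
  rw [covariance_fun_sum_fun_sum (fun k => (g k).memLp_integral (hV.memLp k))
    (fun k => (g' k).memLp_integral (hV.memLp k))]
  refine Finset.sum_congr rfl fun k _ => ?_
  rw [Finset.sum_eq_single k]
  · exact StepFun.covariance_integral (hV.brownian k) _ _
  · intro k' _ hk'
    have := (hV.indep.indepFun hk'.symm).comp (measurable_stepFun_integral (g k))
      (measurable_stepFun_integral (g' k'))
    exact IndepFun.covariance_eq_zero this ((g k).memLp_integral (hV.memLp k))
      ((g' k').memLp_integral (hV.memLp k'))
  · simp

theorem memLp_sum_stepFun_integral (hV : IsBrownianVec P V) (g : Fin m → StepFun) :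
    MemLp (fun ω => ∑ k, (g k).integral (V k) ω) 2 P :=
  memLp_finsetSum _ fun k _ => (g k).memLp_integral (hV.memLp k)

variable {f f' : ℝ → Fin m → ℝ} {s u : ℝ} {J J' : Ω → ℝ}

theorem IsWienerIntegral.memLp (hV : IsBrownianVec P V) (h : IsWienerIntegral P V f s J)
    (hJ : AEStronglyMeasurable J P) : MemLp J 2 P := by
  obtain ⟨g, -, hg⟩ := h
  exact memLp_of_tendsto_eLpNorm (fun n => memLp_sum_stepFun_integral hV (g n)) hJ hg

/-- The Itô isometry, in its polarized form, for integrals of deterministic functions. -/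
theorem IsWienerIntegral.covariance_eq [IsProbabilityMeasure P] (hV : IsBrownianVec P V)
    (h : IsWienerIntegral P V f s J) (h' : IsWienerIntegral P V f' u J')
    (hJ : MemLp J 2 P) (hJ' : MemLp J' 2 P)
    (hf : ∀ k, MemLp ((Set.Ioc 0 s).indicator fun r => f r k) 2 volume)
    (hf' : ∀ k, MemLp ((Set.Ioc 0 u).indicator fun r => f' r k) 2 volume) :
    cov[J, J'; P] = ∑ k, ∫ r, (Set.Ioc 0 s).indicator (fun r => f r k) r *
      (Set.Ioc 0 u).indicator (fun r => f' r k) r := by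
  obtain ⟨g, hg, hgJ⟩ := h
  obtain ⟨g', hg', hgJ'⟩ := h'
  have h1 := tendsto_covariance_of_eLpNorm (fun n => memLp_sum_stepFun_integral hV (g n))
    (fun n => memLp_sum_stepFun_integral hV (g' n)) hJ hJ' hgJ hgJ'
  refine tendsto_nhds_unique h1 ?_
  simp only [hV.covariance_stepFun_integral]
  exact tendsto_finsetSum _ fun k _ => tendsto_integral_mul_of_eLpNorm
    (fun n => (g n k).memLp_eval) (fun n => (g' n k).memLp_eval) (hf k) (hf' k) (hg k) (hg' k)

/-- A variable which is independent of the Brownian motion is uncorrelated with its Wiener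
integrals. -/
theorem IsWienerIntegral.covariance_eq_zero [IsProbabilityMeasure P] (hV : IsBrownianVec P V)
    (h : IsWienerIntegral P V f s J) (hJ : MemLp J 2 P) {X : Ω → ℝ} (hX : MemLp X 2 P)
    (hind : IndepFun X (fun ω k r => V k r ω) P) : cov[X, J; P] = 0 := by
  obtain ⟨g, -, hg⟩ := h
  have h1 := tendsto_covariance_of_eLpNorm (fun _ => hX)
    (fun n => memLp_sum_stepFun_integral hV (g n)) hX hJ (by simp) hg
  refine tendsto_nhds_unique h1 (tendsto_const_nhds.congr fun n => ?_)
  symm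
  have hmeas : Measurable fun x : Fin m → ℝ≥0 → ℝ =>
      ∑ k, ∑ q, (g n k).coeff q * (x k ((g n k).right q) - x k ((g n k).left q)) := by
    fun_prop
  exact IndepFun.covariance_eq_zero (hind.comp measurable_id hmeas) hX
    (memLp_sum_stepFun_integral hV (g n))

end Wiener

/-! ### Processes bounded in `L²` and their time integrals -/

section TimeIntegral

variable {Ω : Type*} [MeasurableSpace Ω] {P : Measure Ω} {v : ℝ} {Z : ℝ → Ω → ℝ}

/-- A process with almost surely continuous paths is jointly measurable, being the limit of its
discretizations in time. -/
theorem aemeasurable_uncurry_of_continuousOn [SFinite P] (hv : 0 ≤ v)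
    (hZm : ∀ s ∈ Set.Icc 0 v, AEMeasurable (Z s) P)
    (hZc : ∀ᵐ ω ∂P, ContinuousOn (fun s => Z s ω) (Set.Icc 0 v)) :
    AEMeasurable (fun q : ℝ × Ω => Z q.1 q.2) ((volume.restrict (Set.Ioc 0 v)).prod P) := by
  -- The grid points are truncated at `v`, because `Z` is only controlled on `[0, v]`.
  let x : ℕ → ℝ := fun n => (n : ℝ) + 1
  let grid : ℕ → ℕ → ℝ := fun n k => min ((k : ℝ) / x n) v
  have hgrid : ∀ n k, grid n k ∈ Set.Icc 0 v := fun n k =>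
    ⟨le_min (by positivity) hv, min_le_right _ _⟩
  have hgm : ∀ n k, ∃ f, Measurable f ∧ Z (grid n k) =ᵐ[P] f := fun n k => hZm _ (hgrid n k)
  choose f hf hfe using hgm
  have hκ : ∀ n, Measurable fun r : ℝ => ⌊r * x n⌋₊ := fun n =>
    Nat.measurable_floor.comp (measurable_id.mul_const _)
  refine aemeasurable_of_tendsto_metrizable_ae (u := atTop)
    (f := fun n (q : ℝ × Ω) => Z (grid n ⌊q.1 * x n⌋₊) q.2) (fun n => ?_) ?_
  · have hmeas : Measurable fun q : ℝ × Ω => f n ⌊q.1 * x n⌋₊ q.2 := by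
      have h1 : Measurable fun q : Ω × ℕ => f n q.2 q.1 :=
        measurable_from_prod_countable_left fun k => hf n k
      exact h1.comp (measurable_snd.prodMk ((hκ n).comp measurable_fst))
    refine ⟨_, hmeas, ?_⟩
    have hae : ∀ᵐ ω ∂P, ∀ k, Z (grid n k) ω = f n k ω := ae_all_iff.2 fun k => hfe n k
    have := Measure.quasiMeasurePreserving_snd (μ := volume.restrict (Set.Ioc 0 v)) (ν := P)
      |>.ae hae
    filter_upwards [this] with q hq using hq _
  · have h1 := Measure.quasiMeasurePreserving_snd (μ := volume.restrict (Set.Ioc 0 v)) (ν := P)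
      |>.ae hZc
    have h2 := Measure.quasiMeasurePreserving_fst (μ := volume.restrict (Set.Ioc 0 v)) (ν := P)
      |>.ae (ae_restrict_mem measurableSet_Ioc)
    filter_upwards [h1, h2] with q hq1 hq2
    have hq : q.1 ∈ Set.Icc 0 v := Set.Ioc_subset_Icc_self hq2
    have hlim : Tendsto (fun n => grid n ⌊q.1 * x n⌋₊) atTop (𝓝 q.1) := by
      have hx : Tendsto x atTop atTop :=
        tendsto_atTop_add_const_right _ _ tendsto_natCast_atTop_atTop
      have := ((tendsto_nat_floor_mul_div_atTop hq.1).comp hx).min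
        (tendsto_const_nhds (x := v))
      rwa [min_eq_left hq.2] at this
    exact (hq1 q.1 hq).tendsto.comp
      (tendsto_nhdsWithin_iff.2 ⟨hlim, Eventually.of_forall fun n => hgrid n _⟩)

/-- A real process on `[0, v]` with almost surely continuous paths which is bounded in `L²`. -/
structure IsSquareBounded (P : Measure Ω) (v : ℝ) (Z : ℝ → Ω → ℝ) : Prop where
  continuous : ∀ᵐ ω ∂P, ContinuousOn (fun s => Z s ω) (Set.Icc 0 v)
  memLp : ∀ s ∈ Set.Icc 0 v, MemLp (Z s) 2 P
  bound : ∃ C, ∀ s ∈ Set.Icc 0 v, ∫ ω, Z s ω ^ 2 ∂P ≤ C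

theorem IsSquareBounded.mono (hZ : IsSquareBounded P v Z) {s : ℝ} (hs : s ≤ v) :
    IsSquareBounded P s Z := by
  have hsub := Set.Icc_subset_Icc_right (b := (0 : ℝ)) hs
  obtain ⟨C, hC⟩ := hZ.bound
  exact ⟨hZ.continuous.mono fun ω h => h.mono hsub, fun r hr => hZ.memLp r (hsub hr),
    C, fun r hr => hC r (hsub hr)⟩

theorem aestronglyMeasurable_intervalIntegral [SFinite P] (hv : 0 ≤ v)
    (hZm : ∀ s ∈ Set.Icc 0 v, AEMeasurable (Z s) P)
    (hZc : ∀ᵐ ω ∂P, ContinuousOn (fun s => Z s ω) (Set.Icc 0 v)) {g : ℝ → ℝ}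
    (hg : IntervalIntegrable g volume 0 v) :
    AEStronglyMeasurable (fun ω => ∫ r in (0 : ℝ)..v, g r * Z r ω) P := by
  rw [intervalIntegrable_iff_integrableOn_Ioc_of_le hv] at hg
  have h1 : AEStronglyMeasurable (fun q : ℝ × Ω => g q.1 * Z q.1 q.2)
      ((volume.restrict (Set.Ioc 0 v)).prod P) :=
    hg.aestronglyMeasurable.comp_fst.mul
      (aemeasurable_uncurry_of_continuousOn hv hZm hZc).aestronglyMeasurable
  have h2 := h1.prod_swap.integral_prod_right'
  simpa only [intervalIntegral.integral_of_le hv, Prod.fst_swap, Prod.snd_swap] using h2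

/-- Integrability on the product space of `g Z Y`, for a process `Z` bounded in `L²`. -/
theorem integrable_prod_mul [IsProbabilityMeasure P] (hv : 0 ≤ v) {g : ℝ → ℝ}
    (hg : IntervalIntegrable g volume 0 v) {Y : ℝ → Ω → ℝ}
    (hZ : IsSquareBounded P v Z) (hY : IsSquareBounded P v Y) :
    Integrable (fun q : ℝ × Ω => g q.1 * (Z q.1 q.2 * Y q.1 q.2))
      ((volume.restrict (Set.Ioc 0 v)).prod P) := by
  rw [intervalIntegrable_iff_integrableOn_Ioc_of_le hv] at hg
  have hm : ∀ {Z : ℝ → Ω → ℝ}, IsSquareBounded P v Z → AEStronglyMeasurable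
      (fun q : ℝ × Ω => Z q.1 q.2) ((volume.restrict (Set.Ioc 0 v)).prod P) := fun h =>
    (aemeasurable_uncurry_of_continuousOn hv
      (fun s hs => (h.memLp s hs).aestronglyMeasurable.aemeasurable) h.continuous)
      |>.aestronglyMeasurable
  have h1 : AEStronglyMeasurable (fun q : ℝ × Ω => g q.1 * (Z q.1 q.2 * Y q.1 q.2))
      ((volume.restrict (Set.Ioc 0 v)).prod P) :=
    hg.aestronglyMeasurable.comp_fst.mul ((hm hZ).mul (hm hY))
  obtain ⟨C, hC⟩ := hZ.bound
  obtain ⟨D, hD⟩ := hY.bound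
  refine (integrable_prod_iff h1).2 ⟨?_, ?_⟩
  · filter_upwards [ae_restrict_mem measurableSet_Ioc] with r hr
    have hr' := Set.Ioc_subset_Icc_self hr
    exact ((hZ.memLp r hr').integrable_mul (hY.memLp r hr')).const_mul _
  · refine Integrable.mono' (g := fun r => |g r| * (C + D)) (hg.abs.mul_const _)
      h1.norm.integral_prod_right' ?_
    filter_upwards [ae_restrict_mem measurableSet_Ioc] with r hr
    have hr' := Set.Ioc_subset_Icc_self hr
    have hZi := (hZ.memLp r hr').integrable_sq
    have hYi := (hY.memLp r hr').integrable_sq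
    rw [Real.norm_of_nonneg (integral_nonneg fun _ => norm_nonneg _)]
    simp only [norm_mul, Real.norm_eq_abs]
    rw [integral_const_mul]
    gcongr
    calc ∫ ω, |Z r ω| * |Y r ω| ∂P ≤ ∫ ω, (Z r ω ^ 2 + Y r ω ^ 2) ∂P := by
          refine integral_mono_of_nonneg (Eventually.of_forall fun ω => by positivity)
            (hZi.add hYi) (Eventually.of_forall fun ω => ?_)
          simp only
          nlinarith [sq_nonneg (|Z r ω| - |Y r ω|), sq_abs (Z r ω), sq_abs (Y r ω),
            sq_nonneg (Z r ω), sq_nonneg (Y r ω)]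
      _ ≤ C + D := by
          rw [integral_add hZi hYi]
          exact add_le_add (hC r hr') (hD r hr')

/-- The Cauchy-Schwarz inequality with respect to the weight `|g|`. -/
theorem sq_intervalIntegral_mul_le (hv : 0 ≤ v) {g z : ℝ → ℝ}
    (hg : IntervalIntegrable g volume 0 v) (hz : ContinuousOn z (Set.Icc 0 v)) :
    (∫ r in (0 : ℝ)..v, g r * z r) ^ 2 ≤
      (∫ r in (0 : ℝ)..v, |g r|) * ∫ r in (0 : ℝ)..v, |g r| * z r ^ 2 := by
  rw [← Set.uIcc_of_le hv] at hz
  have h1 : IntervalIntegrable (fun r => |g r| * |z r|) volume 0 v :=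
    hg.abs.mul_continuousOn hz.abs
  have h2 : IntervalIntegrable (fun r => |g r| * z r ^ 2) volume 0 v :=
    hg.abs.mul_continuousOn (hz.pow 2)
  -- The quadratic polynomial `c ↦ ∫ |g| (|z| - c)²` is nonnegative, so its discriminant is not
  -- positive.
  have hdisc : ∀ c : ℝ, 0 ≤ (∫ r in (0 : ℝ)..v, |g r|) * (c * c) +
      (-2 * ∫ r in (0 : ℝ)..v, |g r| * |z r|) * c + ∫ r in (0 : ℝ)..v, |g r| * z r ^ 2 := by
    intro c
    have : ∫ r in (0 : ℝ)..v, |g r| * (|z r| - c) ^ 2 =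
        (∫ r in (0 : ℝ)..v, |g r|) * (c * c) +
        (-2 * ∫ r in (0 : ℝ)..v, |g r| * |z r|) * c + ∫ r in (0 : ℝ)..v, |g r| * z r ^ 2 := by
      rw [← intervalIntegral.integral_const_mul, ← intervalIntegral.integral_mul_const,
        ← intervalIntegral.integral_mul_const, ← intervalIntegral.integral_add
        (hg.abs.mul_const _) ((h1.const_mul _).mul_const _), ← intervalIntegral.integral_add
        ((hg.abs.mul_const _).add ((h1.const_mul _).mul_const _)) h2]
      refine intervalIntegral.integral_congr fun r _ => ?_
      rw [← sq_abs (z r)]; ring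
    rw [← this]
    exact intervalIntegral.integral_nonneg hv fun r _ => by positivity
  have h3 := discrim_le_zero hdisc
  have h4 : |∫ r in (0 : ℝ)..v, g r * z r| ≤ ∫ r in (0 : ℝ)..v, |g r| * |z r| := by
    refine (intervalIntegral.abs_integral_le_integral_abs hv).trans (le_of_eq ?_)
    simp only [abs_mul]
  have h5 : (∫ r in (0 : ℝ)..v, g r * z r) ^ 2 ≤ (∫ r in (0 : ℝ)..v, |g r| * |z r|) ^ 2 :=
    sq_le_sq' (by linarith [neg_abs_le (∫ r in (0 : ℝ)..v, g r * z r)])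
      ((le_abs_self _).trans h4)
  rw [discrim] at h3
  nlinarith

theorem IsSquareBounded.const_of_memLp {Y : Ω → ℝ} (hY : MemLp Y 2 P) :
    IsSquareBounded P v (fun _ => Y) :=
  ⟨Eventually.of_forall fun _ => continuousOn_const, fun _ _ => hY, _, fun _ _ => le_rfl⟩

theorem IsSquareBounded.add {Y : ℝ → Ω → ℝ} (hZ : IsSquareBounded P v Z)
    (hY : IsSquareBounded P v Y) :
    IsSquareBounded P v (fun s ω => Z s ω + Y s ω) := by
  obtain ⟨C, hC⟩ := hZ.bound
  obtain ⟨D, hD⟩ := hY.bound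
  refine ⟨?_, fun s hs => (hZ.memLp s hs).add (hY.memLp s hs), 2 * C + 2 * D, fun s hs => ?_⟩
  · filter_upwards [hZ.continuous, hY.continuous] with ω h1 h2 using h1.add h2
  · have hZi := (hZ.memLp s hs).integrable_sq
    have hYi := (hY.memLp s hs).integrable_sq
    calc ∫ ω, (Z s ω + Y s ω) ^ 2 ∂P ≤ ∫ ω, (2 * Z s ω ^ 2 + 2 * Y s ω ^ 2) ∂P := by
          refine integral_mono_of_nonneg (Eventually.of_forall fun ω => by positivity)
            ((hZi.const_mul 2).add (hYi.const_mul 2)) (Eventually.of_forall fun ω => ?_)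
          simp only
          nlinarith [sq_nonneg (Z s ω - Y s ω)]
      _ ≤ 2 * C + 2 * D := by
          rw [integral_add (hZi.const_mul 2) (hYi.const_mul 2), integral_const_mul,
            integral_const_mul]
          linarith [hC s hs, hD s hs]

theorem IsSquareBounded.sum {ι : Type*} (t : Finset ι) {Y : ι → ℝ → Ω → ℝ}
    (hY : ∀ i ∈ t, IsSquareBounded P v (Y i)) :
    IsSquareBounded P v (fun s ω => ∑ i ∈ t, Y i s ω) := by
  classical
  induction t using Finset.induction_on with
  | empty => exact IsSquareBounded.const_of_memLp (Y := fun _ => 0) MemLp.zero'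
  | insert i t hi ih =>
    simp only [Finset.sum_insert hi]
    exact (hY i (Finset.mem_insert_self i t)).add
      (ih fun j hj => hY j (Finset.mem_insert_of_mem hj))

theorem IsSquareBounded.mul_left (hZ : IsSquareBounded P v Z) {g : ℝ → ℝ}
    (hg : ContinuousOn g (Set.Icc 0 v)) : IsSquareBounded P v (fun s ω => g s * Z s ω) := by
  obtain ⟨C, hC⟩ := hZ.bound
  obtain ⟨D, hD⟩ := isCompact_Icc.exists_bound_of_continuousOn hg
  refine ⟨?_, fun s hs => (hZ.memLp s hs).const_mul _, D ^ 2 * C, fun s hs => ?_⟩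
  · filter_upwards [hZ.continuous] with ω h using hg.mul h
  · simp only [mul_pow]
    rw [integral_const_mul]
    have h1 : g s ^ 2 ≤ D ^ 2 := by
      rw [← sq_abs]
      exact pow_le_pow_left₀ (abs_nonneg _) (hD s hs) 2
    exact mul_le_mul h1 (hC s hs) (integral_nonneg fun _ => sq_nonneg _) (sq_nonneg _)

/-- The time integral of a process bounded in `L²` is square integrable, with the bound given by
the Cauchy-Schwarz inequality. -/
theorem memLp_intervalIntegral [IsProbabilityMeasure P] (hv : 0 ≤ v) {g : ℝ → ℝ}
    (hg : IntervalIntegrable g volume 0 v) (hZ : IsSquareBounded P v Z) :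
    MemLp (fun ω => ∫ r in (0 : ℝ)..v, g r * Z r ω) 2 P ∧
    ∫ ω, (∫ r in (0 : ℝ)..v, g r * Z r ω) ^ 2 ∂P ≤
      (∫ r in (0 : ℝ)..v, |g r|) * ∫ r in (0 : ℝ)..v, |g r| * ∫ ω, Z r ω ^ 2 ∂P := by
  have hm := aestronglyMeasurable_intervalIntegral hv
    (fun s hs => (hZ.memLp s hs).aestronglyMeasurable.aemeasurable) hZ.continuous hg
  have hprod := integrable_prod_mul hv hg.abs hZ hZ
  have hQ : Integrable (fun ω => (∫ r in (0 : ℝ)..v, |g r|) *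
      ∫ r in (0 : ℝ)..v, |g r| * Z r ω ^ 2) P := by
    simp only [intervalIntegral.integral_of_le hv, sq]
    exact hprod.integral_prod_right.const_mul _
  have hle : ∀ᵐ ω ∂P, (∫ r in (0 : ℝ)..v, g r * Z r ω) ^ 2 ≤ (∫ r in (0 : ℝ)..v, |g r|) *
      ∫ r in (0 : ℝ)..v, |g r| * Z r ω ^ 2 :=
    hZ.continuous.mono fun ω hω => sq_intervalIntegral_mul_le hv hg hω
  constructor
  · rw [memLp_two_iff_integrable_sq hm]
    refine hQ.mono' (hm.pow 2) ?_
    filter_upwards [hle] with ω hω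
    rwa [Real.norm_of_nonneg (sq_nonneg _)]
  · refine (integral_mono_of_nonneg (Eventually.of_forall fun ω => sq_nonneg _) hQ hle).trans
      (le_of_eq ?_)
    rw [integral_const_mul]
    congr 1
    simp only [intervalIntegral.integral_of_le hv, ← integral_const_mul, sq]
    exact (integral_integral_swap hprod).symm

/-- The indefinite integral of a process which is bounded in `L²` is again bounded in `L²`. -/
theorem IsSquareBounded.primitive [IsProbabilityMeasure P] (hv : 0 ≤ v) {g : ℝ → ℝ}
    (hg : IntervalIntegrable g volume 0 v) (hZ : IsSquareBounded P v Z) :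
    IsSquareBounded P v (fun s ω => ∫ r in (0 : ℝ)..s, g r * Z r ω) := by
  have hsub : ∀ s ∈ Set.Icc 0 v, IntervalIntegrable g volume 0 s := fun s hs =>
    intervalIntegrable_mono hg le_rfl hs.1 hs.2
  obtain ⟨C, hC⟩ := hZ.bound
  have hC0 : 0 ≤ C := (integral_nonneg fun _ => sq_nonneg _).trans (hC 0 ⟨le_rfl, hv⟩)
  refine ⟨?_, fun s hs => (memLp_intervalIntegral hs.1 (hsub s hs) (hZ.mono hs.2)).1,
    (∫ r in (0 : ℝ)..v, |g r|) * ((∫ r in (0 : ℝ)..v, |g r|) * C), fun s hs => ?_⟩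
  · filter_upwards [hZ.continuous] with ω hω
    have hi : IntervalIntegrable (fun r => g r * Z r ω) volume 0 v :=
      hg.mul_continuousOn (by rwa [Set.uIcc_of_le hv])
    exact primitive_continuousOn hv hi fun s hs => by simp
  · have h1 := (memLp_intervalIntegral hs.1 (hsub s hs) (hZ.mono hs.2)).2
    have hmono : ∫ r in (0 : ℝ)..s, |g r| ≤ ∫ r in (0 : ℝ)..v, |g r| :=
      intervalIntegral.integral_mono_interval le_rfl hs.1 hs.2
        (Eventually.of_forall fun _ => abs_nonneg _) hg.abs
    have h2 : ∫ r in (0 : ℝ)..s, |g r| * ∫ ω, Z r ω ^ 2 ∂P ≤ (∫ r in (0 : ℝ)..s, |g r|) * C := by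
      rw [← intervalIntegral.integral_mul_const]
      have hprod := integrable_prod_mul hs.1 (hsub s hs).abs (hZ.mono hs.2) (hZ.mono hs.2)
      have hint : IntervalIntegrable (fun r => |g r| * ∫ ω, Z r ω ^ 2 ∂P) volume 0 s := by
        rw [intervalIntegrable_iff_integrableOn_Ioc_of_le hs.1]
        have := hprod.integral_prod_left
        simp only [integral_const_mul, ← sq] at this
        exact this
      refine intervalIntegral.integral_mono_on hs.1 hint ((hsub s hs).abs.mul_const _)
        fun r hr => ?_
      exact mul_le_mul_of_nonneg_left (hC r ⟨hr.1, hr.2.trans hs.2⟩) (abs_nonneg _)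
    have h0 : 0 ≤ ∫ r in (0 : ℝ)..s, |g r| :=
      intervalIntegral.integral_nonneg hs.1 fun _ _ => abs_nonneg _
    refine h1.trans (mul_le_mul hmono (h2.trans (mul_le_mul_of_nonneg_right hmono hC0)) ?_
      (h0.trans hmono))
    exact intervalIntegral.integral_nonneg hs.1 fun r _ =>
      mul_nonneg (abs_nonneg _) (integral_nonneg fun _ => sq_nonneg _)

/-- Covariance with a fixed square integrable variable commutes with integration in time. -/
theorem covariance_intervalIntegral [IsProbabilityMeasure P] (hv : 0 ≤ v) {g : ℝ → ℝ}
    (hg : IntervalIntegrable g volume 0 v) (hZ : IsSquareBounded P v Z) {Y : Ω → ℝ}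
    (hY : MemLp Y 2 P) :
    IntervalIntegrable (fun r => g r * cov[Z r, Y; P]) volume 0 v ∧
    cov[fun ω => ∫ r in (0 : ℝ)..v, g r * Z r ω, Y; P] =
      ∫ r in (0 : ℝ)..v, g r * cov[Z r, Y; P] := by
  -- It is enough to center one of the two variables in a covariance.
  set e : ℝ := ∫ ω, Y ω ∂P
  have hY' : MemLp (fun ω => Y ω - e) 2 P := hY.sub (memLp_const e)
  have hcov : ∀ {X : Ω → ℝ}, MemLp X 2 P → cov[X, Y; P] = ∫ ω, X ω * (Y ω - e) ∂P := by
    intro X hX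
    have hXY : Integrable (fun ω => X ω * Y ω) P := hX.integrable_mul hY
    have hXi : Integrable X P := hX.integrable (by norm_num)
    rw [covariance_eq_sub hX hY]
    simp only [mul_sub]
    rw [integral_sub hXY (hXi.mul_const e), integral_mul_const]
    rfl
  have hprod := integrable_prod_mul hv hg hZ (IsSquareBounded.const_of_memLp (v := v) hY')
  have hpt : ∀ r ∈ Set.Ioc 0 v, ∫ ω, g r * (Z r ω * (Y ω - e)) ∂P = g r * cov[Z r, Y; P] := by
    intro r hr
    rw [integral_const_mul, hcov (hZ.memLp r (Set.Ioc_subset_Icc_self hr))]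
  constructor
  · rw [intervalIntegrable_iff_integrableOn_Ioc_of_le hv]
    refine hprod.integral_prod_left.congr ?_
    filter_upwards [ae_restrict_mem measurableSet_Ioc] with r hr using hpt r hr
  · rw [hcov (memLp_intervalIntegral hv hg hZ).1]
    simp only [intervalIntegral.integral_of_le hv]
    rw [← setIntegral_congr_fun measurableSet_Ioc hpt, integral_integral_swap hprod]
    refine integral_congr_ae (Eventually.of_forall fun ω => ?_)
    simp only
    rw [← integral_mul_const]
    simp only [mul_assoc]

end TimeIntegral

/-! ### Linear stochastic differential equations -/

section SDE

variable {Ω : Type*} [MeasurableSpace Ω] {P : Measure Ω} {d m : ℕ} {v : ℝ}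

theorem memLp_indicator {f : ℝ → ℝ} (hf : MemLp ((Set.Ioc 0 v).indicator f) 2 volume) {s : ℝ}
    (hs : s ≤ v) : MemLp ((Set.Ioc 0 s).indicator f) 2 volume := by
  have := hf.indicator (measurableSet_Ioc (a := (0 : ℝ)) (b := s))
  rwa [Set.indicator_indicator, Set.inter_eq_left.2 (Set.Ioc_subset_Ioc_right hs)] at this

theorem covMatrix_transpose (X Y : Ω → Fin d → ℝ) : (covMatrix P X Y)ᵀ = covMatrix P Y X := by
  ext i j
  simp only [covMatrix, Matrix.transpose_apply, Matrix.of_apply]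
  exact covariance_comm _ _

theorem IsWienerIntegral.integral_eq_zero [IsProbabilityMeasure P] {V : Fin m → ℝ≥0 → Ω → ℝ}
    (hV : IsBrownianVec P V) {f : ℝ → Fin m → ℝ} {s : ℝ} {J : Ω → ℝ}
    (h : IsWienerIntegral P V f s J) (hJ : MemLp J 2 P) : ∫ ω, J ω ∂P = 0 := by
  obtain ⟨g, -, hg⟩ := h
  have h1 := tendsto_integral_mul_of_eLpNorm (fun n => memLp_sum_stepFun_integral hV (g n))
    (fun _ => memLp_const (1 : ℝ)) hJ (memLp_const 1) hg (by simp)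
  simp only [mul_one] at h1
  refine tendsto_nhds_unique h1 (tendsto_const_nhds.congr fun n => ?_)
  rw [integral_finsetSum _ fun k _ =>
    ((g n k).memLp_integral (hV.memLp k)).integrable (by norm_num)]
  refine (Finset.sum_eq_zero fun k _ => ?_).symm
  have hint : ∀ t, Integrable (V k t) P := fun t => (hV.memLp k t).integrable (by norm_num)
  have h0 : ∀ t, ∫ ω, V k t ω ∂P = 0 := (hV.brownian k).toIsPreBrownianReal.integral_eval
  simp only [StepFun.integral]
  rw [integral_finsetSum]
  swap
  · exact fun q _ => ((hint _).sub (hint _)).const_mul _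
  refine Finset.sum_eq_zero fun q _ => ?_
  rw [integral_const_mul, integral_sub (hint _) (hint _), h0, h0]
  simp

/-- What remains of the increment `ξ_s - ξ_0` after subtraction of the drift `∫₀ˢ A_r ξ_r dr`. -/
noncomputable def noise (A : ℝ → Matrix (Fin d) (Fin d) ℝ) (ξ : ℝ → Ω → Fin d → ℝ) (s : ℝ) (ω : Ω)
    (i : Fin d) : ℝ :=
  ξ s ω i - ξ 0 ω i - ∫ r in (0 : ℝ)..s, (A r *ᵥ ξ r ω) i

/-- `ξ` solves `dξ_s = A(s) ξ_s ds + b(s) dV_s` on `[0, v]`, and its initial value is square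
integrable and independent of `V`. -/
structure IsLinearSolution (P : Measure Ω) (V : Fin m → ℝ≥0 → Ω → ℝ) (v : ℝ)
    (A : ℝ → Matrix (Fin d) (Fin d) ℝ) (b : ℝ → Matrix (Fin d) (Fin m) ℝ)
    (ξ : ℝ → Ω → Fin d → ℝ) : Prop where
  memLp_zero : ∀ i, MemLp (fun ω => ξ 0 ω i) 2 P
  indep_zero : IndepFun (ξ 0) (fun ω k r => V k r ω) P
  aemeasurable : ∀ s ∈ Set.Icc 0 v, AEMeasurable (ξ s) P
  continuous : ∀ᵐ ω ∂P, ContinuousOn (fun s => ξ s ω) (Set.Icc 0 v)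
  sde : ∀ s ∈ Set.Icc 0 v, ∀ i,
    IsWienerIntegral P V (fun r => b r i) s fun ω => noise A ξ s ω i

namespace IsLinearSolution

variable {V : Fin m → ℝ≥0 → Ω → ℝ} {A Φ Ψ : ℝ → Matrix (Fin d) (Fin d) ℝ}
  {b : ℝ → Matrix (Fin d) (Fin m) ℝ} {ξ : ℝ → Ω → Fin d → ℝ}

/-- Pathwise, `ξ - noise` is absolutely continuous with derivative `A ξ`. The vectors are written as
matrices with one column. -/
theorem noise_isPrimitiveOn {Ω : Type*} {ξ : ℝ → Ω → Fin d → ℝ} (hv : 0 ≤ v)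
    (hA : ∀ i j, IntervalIntegrable (fun r => A r i j) volume 0 v) {ω : Ω}
    (hω : ContinuousOn (fun s => ξ s ω) (Set.Icc 0 v)) :
    IsPrimitiveOn 0 v (fun s => Matrix.of fun i (_ : Unit) => ξ s ω i - noise A ξ s ω i)
      (fun r => A r * Matrix.of fun i (_ : Unit) => ξ r ω i) := by
  refine ⟨intervalIntegrable_mul_right hv (fun i j => ?_) hA, fun s hs i j => ?_⟩
  · exact continuousOn_pi.1 hω i
  · simp only [Matrix.of_apply, noise, intervalIntegral.integral_same, sub_self, sub_zero]
    simp only [sub_sub_cancel, sub_sub]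
    simp only [Matrix.mul_apply, Matrix.mulVec, dotProduct, Matrix.of_apply]

theorem continuousOn_noise {Ω : Type*} {ξ : ℝ → Ω → Fin d → ℝ} (hv : 0 ≤ v)
    (hA : ∀ i j, IntervalIntegrable (fun r => A r i j) volume 0 v) {ω : Ω}
    (hω : ContinuousOn (fun s => ξ s ω) (Set.Icc 0 v)) (i : Fin d) :
    ContinuousOn (fun s => noise A ξ s ω i) (Set.Icc 0 v) := by
  have h := ((noise_isPrimitiveOn hv hA hω).continuousOn hv i ())
  exact ((continuousOn_pi.1 hω i).sub h).congr fun s _ => by simp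

theorem aemeasurable_apply (h : IsLinearSolution P V v A b ξ) (i : Fin d) :
    ∀ s ∈ Set.Icc 0 v, AEMeasurable (fun ω => ξ s ω i) P := fun s hs =>
  (measurable_pi_apply i).comp_aemeasurable (h.aemeasurable s hs)

theorem continuous_apply (h : IsLinearSolution P V v A b ξ) (i : Fin d) :
    ∀ᵐ ω ∂P, ContinuousOn (fun s => ξ s ω i) (Set.Icc 0 v) :=
  h.continuous.mono fun _ hω => continuousOn_pi.1 hω i

variable [IsProbabilityMeasure P]

/-- The drift integral is measurable in `ω`, hence so is the noise; its square integrability is then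
inherited from the approximating elementary integrals. -/
theorem memLp_noise (h : IsLinearSolution P V v A b ξ) (hV : IsBrownianVec P V) (hv : 0 ≤ v)
    (hA : ∀ i j, IntervalIntegrable (fun r => A r i j) volume 0 v) (i : Fin d) {s : ℝ}
    (hs : s ∈ Set.Icc 0 v) : MemLp (fun ω => noise A ξ s ω i) 2 P := by
  refine (h.sde s hs i).memLp hV ?_
  have hdrift : AEStronglyMeasurable
      (fun ω => ∑ j, ∫ r in (0 : ℝ)..s, A r i j * ξ r ω j) P := by
    refine Finset.aestronglyMeasurable_fun_sum _ fun j _ =>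
      aestronglyMeasurable_intervalIntegral hs.1
        (fun r hr => h.aemeasurable_apply j r ⟨hr.1, hr.2.trans hs.2⟩) ?_
        (intervalIntegrable_mono (hA i j) le_rfl hs.1 hs.2)
    exact (h.continuous_apply j).mono fun ω hω => hω.mono (Set.Icc_subset_Icc_right hs.2)
  refine (((h.aemeasurable_apply i s hs).aestronglyMeasurable.sub
    (h.aemeasurable_apply i 0 ⟨le_rfl, hv⟩).aestronglyMeasurable).sub hdrift).congr ?_
  filter_upwards [h.continuous] with ω hω
  simp only [noise, Pi.sub_apply, Matrix.mulVec, dotProduct]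
  rw [intervalIntegral.integral_finsetSum fun j _ => ?_]
  refine (intervalIntegrable_mono (hA i j) le_rfl hs.1 hs.2).mul_continuousOn ?_
  rw [Set.uIcc_of_le hs.1]
  exact (continuousOn_pi.1 hω j).mono (Set.Icc_subset_Icc_right hs.2)

theorem isSquareBounded_noise (h : IsLinearSolution P V v A b ξ) (hV : IsBrownianVec P V)
    (hv : 0 ≤ v)
    (hA : ∀ i j, IntervalIntegrable (fun r => A r i j) volume 0 v)
    (hb : ∀ i k, MemLp ((Set.Ioc 0 v).indicator fun r => b r i k) 2 volume) (i : Fin d) :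
    IsSquareBounded P v (fun s ω => noise A ξ s ω i) := by
  refine ⟨h.continuous.mono fun ω hω => continuousOn_noise hv hA hω i,
    fun s hs => h.memLp_noise hV hv hA i hs,
    ∑ k, ∫ r, (Set.Ioc 0 v).indicator (fun r => b r i k) r ^ 2, fun s hs => ?_⟩
  have hM := h.memLp_noise hV hv hA i hs
  have hb' := fun k => memLp_indicator (hb i k) hs.2
  have h1 := (h.sde s hs i).covariance_eq hV (h.sde s hs i) hM hM hb' hb'
  rw [covariance_eq_sub hM hM, (h.sde s hs i).integral_eq_zero hV hM, mul_zero, sub_zero] at h1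
  have h2 : ∫ ω, noise A ξ s ω i ^ 2 ∂P = ∫ ω, ((fun ω => noise A ξ s ω i) *
      fun ω => noise A ξ s ω i) ω ∂P := by simp [sq]
  rw [h2, h1]
  refine Finset.sum_le_sum fun k _ => integral_mono ((hb' k).integrable_mul (hb' k))
    (hb i k).integrable_sq fun r => ?_
  simp only [← sq]
  by_cases hr : r ∈ Set.Ioc 0 s
  · rw [Set.indicator_of_mem hr, Set.indicator_of_mem (Set.Ioc_subset_Ioc_right hs.2 hr)]
  · rw [Set.indicator_of_notMem hr, zero_pow two_ne_zero]
    exact sq_nonneg _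

/-- Variation of constants along the paths represents the solution through the noise, which shows
that it is bounded in `L²`. -/
theorem isSquareBounded (h : IsLinearSolution P V v A b ξ) (hV : IsBrownianVec P V) (hv : 0 ≤ v)
    (hA : ∀ i j, IntervalIntegrable (fun r => A r i j) volume 0 v)
    (hb : ∀ i k, MemLp ((Set.Ioc 0 v).indicator fun r => b r i k) 2 volume) (i : Fin d) :
    IsSquareBounded P v (fun s ω => ξ s ω i) := by
  obtain ⟨Φ, Ψ, -, hΨ0, hΦ, hΨ, hΨΦ⟩ := exists_fundamental hv hA
  have hΨA : ∀ i j, IntervalIntegrable (fun r => (Ψ r * A r) i j) volume 0 v :=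
    intervalIntegrable_mul_left hv (hΨ.continuousOn hv) hA
  have hM := h.isSquareBounded_noise hV hv hA hb
  have hR : IsSquareBounded P v (fun s ω => noise A ξ s ω i + ∑ j, Φ s i j *
      (ξ 0 ω j + ∑ k, ∫ r in (0 : ℝ)..s, (Ψ r * A r) j k * noise A ξ r ω k)) := by
    refine (hM i).add (IsSquareBounded.sum _ fun j _ =>
      IsSquareBounded.mul_left ?_ (hΦ.continuousOn hv i j))
    exact (IsSquareBounded.const_of_memLp (h.memLp_zero j)).add
      (IsSquareBounded.sum _ fun k _ => (hM k).primitive hv (hΨA j k))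
  have heq : ∀ᵐ ω ∂P, ∀ s ∈ Set.Icc 0 v, noise A ξ s ω i + ∑ j, Φ s i j *
      (ξ 0 ω j + ∑ k, ∫ r in (0 : ℝ)..s, (Ψ r * A r) j k * noise A ξ r ω k) = ξ s ω i := by
    filter_upwards [h.continuous] with ω hω s hs
    have hy := noise_isPrimitiveOn hv hA hω
    have hΨy := (hΨ.mul hy hv).congr (G' := fun r => (Ψ r * A r) *
      Matrix.of fun i (_ : Unit) => noise A ξ r ω i) (fun _ _ => rfl) (fun r _ => by
        have e : (Matrix.of fun i (_ : Unit) => ξ r ω i - noise A ξ r ω i) =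
          (Matrix.of fun i (_ : Unit) => ξ r ω i) - Matrix.of fun i (_ : Unit) =>
            noise A ξ r ω i := rfl
        rw [e, Matrix.neg_mul, Matrix.mul_sub, Matrix.mul_assoc, Matrix.mul_assoc]
        abel) hv
    have hj : ∀ j, ξ 0 ω j + ∑ k, ∫ r in (0 : ℝ)..s, (Ψ r * A r) j k * noise A ξ r ω k =
        (Ψ s * Matrix.of fun i (_ : Unit) => ξ s ω i - noise A ξ s ω i) j () := by
      intro j
      rw [hΨy.eq s hs j ()]
      congr 1
      · rw [hΨ0, Matrix.one_mul]
        simp [noise]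
      · simp only [Matrix.mul_apply (M := Ψ _ * A _), Matrix.of_apply]
        rw [intervalIntegral.integral_finsetSum fun k _ => ?_]
        refine (intervalIntegrable_mono (hΨA j k) le_rfl hs.1 hs.2).mul_continuousOn ?_
        rw [Set.uIcc_of_le hs.1]
        exact (continuousOn_noise hv hA hω k).mono (Set.Icc_subset_Icc_right hs.2)
    simp only [hj]
    rw [← Matrix.mul_apply, ← Matrix.mul_assoc, mul_eq_one_comm.1 (hΨΦ s hs), Matrix.one_mul]
    simp
  obtain ⟨C, hC⟩ := hR.bound
  refine ⟨h.continuous_apply i, fun s hs => (hR.memLp s hs).ae_eq (heq.mono fun ω hω => hω s hs),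
    C, fun s hs => (le_of_eq ?_).trans (hC s hs)⟩
  refine integral_congr_ae ?_
  filter_upwards [heq] with ω hω
  rw [hω s hs]

/-- The covariance of the solution with a fixed random vector `Y` solves a linear equation whose
inhomogeneous term comes from the covariance of the noise with `Y`. -/
theorem isPrimitiveOn_covMatrix (h : IsLinearSolution P V v A b ξ) (hV : IsBrownianVec P V)
    (hv : 0 ≤ v) (hA : ∀ i j, IntervalIntegrable (fun r => A r i j) volume 0 v)
    (hb : ∀ i k, MemLp ((Set.Ioc 0 v).indicator fun r => b r i k) 2 volume)
    (hΨ : IsPrimitiveOn 0 v Ψ (fun r => -(Ψ r * A r))) {Y : Ω → Fin d → ℝ}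
    (hY : ∀ j, MemLp (fun ω => Y ω j) 2 P) {w : ℝ} (hw : w ∈ Set.Icc 0 v)
    {f : ℝ → Matrix (Fin d) (Fin d) ℝ}
    (hf : IsPrimitiveOn 0 w (fun s => covMatrix P (noise A ξ s) Y) f) :
    IsPrimitiveOn 0 w (fun s => Ψ s * covMatrix P (ξ s) Y) (fun s => Ψ s * f s) := by
  have hξ := h.isSquareBounded hV hv hA hb
  have hint : ∀ i j k, ∀ s ∈ Set.Icc 0 v,
      IntervalIntegrable (fun r => A r i k * covMatrix P (ξ r) Y k j) volume 0 s ∧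
      cov[fun ω => ∫ r in (0 : ℝ)..s, A r i k * ξ r ω k, fun ω => Y ω j; P] =
        ∫ r in (0 : ℝ)..s, A r i k * covMatrix P (ξ r) Y k j := fun i j k s hs =>
    covariance_intervalIntegral hs.1 (intervalIntegrable_mono (hA i k) le_rfl hs.1 hs.2)
      ((hξ k).mono hs.2) (hY j)
  have hAint : ∀ i j, ∀ s ∈ Set.Icc 0 v,
      IntervalIntegrable (fun r => (A r * covMatrix P (ξ r) Y) i j) volume 0 s := by
    intro i j s hs
    simp only [Matrix.mul_apply]
    exact (IntervalIntegrable.sum Finset.univ fun k _ => (hint i j k s hs).1).congr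
      fun r _ => by simp
  have hy : IsPrimitiveOn 0 w (fun s => covMatrix P (ξ s) Y)
      (fun r => A r * covMatrix P (ξ r) Y + f r) := by
    refine ⟨fun i j => (hAint i j w hw).add (hf.integrable i j), fun s hs i j => ?_⟩
    have hs' : s ∈ Set.Icc 0 v := ⟨hs.1, hs.2.trans hw.2⟩
    have hfs := hf.eq s hs i j
    have hn0 : covMatrix P (noise A ξ 0) Y i j = 0 := by
      have : (fun ω => noise A ξ 0 ω i) = 0 := by ext ω; simp [noise]
      simp only [covMatrix, Matrix.of_apply]
      rw [this, covariance_zero_left]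
    rw [hn0, zero_add] at hfs
    have hae : (fun ω => ξ s ω i) =ᵐ[P] fun ω => ξ 0 ω i + ∑ k, (∫ r in (0 : ℝ)..s,
        A r i k * ξ r ω k) + noise A ξ s ω i := by
      filter_upwards [h.continuous] with ω hω
      simp only [noise, Matrix.mulVec, dotProduct]
      rw [intervalIntegral.integral_finsetSum fun k _ => ?_]
      · ring
      · refine (intervalIntegrable_mono (hA i k) le_rfl hs'.1 hs'.2).mul_continuousOn ?_
        rw [Set.uIcc_of_le hs.1]
        exact (continuousOn_pi.1 hω k).mono (Set.Icc_subset_Icc_right hs'.2)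
    have hmem : ∀ k, MemLp (fun ω => ∫ r in (0 : ℝ)..s, A r i k * ξ r ω k) 2 P := fun k =>
      (memLp_intervalIntegral hs.1 (intervalIntegrable_mono (hA i k) le_rfl hs'.1 hs'.2)
        ((hξ k).mono hs'.2)).1
    have hsum : MemLp (fun ω => ∑ k, ∫ r in (0 : ℝ)..s, A r i k * ξ r ω k) 2 P :=
      memLp_finsetSum _ fun k _ => hmem k
    have hcov : cov[fun ω => ξ s ω i, fun ω => Y ω j; P] = cov[fun ω => ξ 0 ω i + ∑ k,
        (∫ r in (0 : ℝ)..s, A r i k * ξ r ω k) + noise A ξ s ω i, fun ω => Y ω j; P] := by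
      simp only [covariance]
      rw [integral_congr_ae hae]
      refine integral_congr_ae ?_
      filter_upwards [hae] with ω hω
      rw [hω]
    have hadd : cov[fun ω => ξ 0 ω i + ∑ k,
        (∫ r in (0 : ℝ)..s, A r i k * ξ r ω k) + noise A ξ s ω i, fun ω => Y ω j; P] =
        cov[fun ω => ξ 0 ω i, fun ω => Y ω j; P] + ∑ k, cov[fun ω => ∫ r in (0 : ℝ)..s,
          A r i k * ξ r ω k, fun ω => Y ω j; P] +
        cov[fun ω => noise A ξ s ω i, fun ω => Y ω j; P] := by
      have e1 := covariance_add_left (X := fun ω => ξ 0 ω i + ∑ k, ∫ r in (0 : ℝ)..s,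
        A r i k * ξ r ω k) (Y := fun ω => noise A ξ s ω i) (Z := fun ω => Y ω j)
        ((h.memLp_zero i).add hsum) (h.memLp_noise hV hv hA i hs') (hY j)
      have e2 := covariance_add_left (X := fun ω => ξ 0 ω i) (Y := fun ω => ∑ k,
        ∫ r in (0 : ℝ)..s, A r i k * ξ r ω k) (Z := fun ω => Y ω j)
        (h.memLp_zero i) hsum (hY j)
      have e3 := covariance_fun_sum_left (X := fun k ω => ∫ r in (0 : ℝ)..s, A r i k * ξ r ω k)
        (Y := fun ω => Y ω j) hmem (hY j)
      exact e1.trans (by rw [← e3]; exact congrArg (· + _) e2)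
    simp only [Matrix.add_apply]
    rw [intervalIntegral.integral_add (hAint i j s hs') (intervalIntegrable_mono
      (hf.integrable i j) le_rfl hs.1 hs.2), ← hfs]
    simp only [Matrix.mul_apply]
    rw [intervalIntegral.integral_finsetSum fun k _ => (hint i j k s hs').1, ← add_assoc]
    simp only [← (hint i j _ s hs').2]
    exact hcov.trans hadd
  exact ((hΨ.mono le_rfl hw.2 hw.1).mul hy hw.1).congr (fun _ _ => rfl)
    (fun r _ => by noncomm_ring) hw.1

/-- Covariance of the noise at the times `s` and `u`, as a function of `s`: it is
`∫₀^{min s u} b bᵀ`. -/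
theorem covMatrix_noise (h : IsLinearSolution P V v A b ξ) (hV : IsBrownianVec P V) (hv : 0 ≤ v)
    (hA : ∀ i j, IntervalIntegrable (fun r => A r i j) volume 0 v)
    (hb : ∀ i k, MemLp ((Set.Ioc 0 v).indicator fun r => b r i k) 2 volume) {u : ℝ}
    (hu : u ∈ Set.Icc 0 v) :
    IsPrimitiveOn 0 v (fun s => covMatrix P (noise A ξ s) (noise A ξ u))
      (fun r => if r ≤ u then b r * (b r)ᵀ else 0) := by
  have hval : ∀ r i j, (if r ≤ u then b r * (b r)ᵀ else 0) i j =
      ∑ k, if r ≤ u then b r i k * b r j k else 0 := by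
    intro r i j
    split_ifs <;> simp [Matrix.mul_apply]
  have hind : ∀ s ∈ Set.Icc 0 v, ∀ i j k, (fun r => (Set.Ioc 0 s).indicator (fun r => b r i k) r *
      (Set.Ioc 0 u).indicator (fun r => b r j k) r) =
      (Set.Ioc 0 s).indicator (fun r => if r ≤ u then b r i k * b r j k else 0) := by
    intro s hs i j k
    ext r
    simp only [Set.indicator_apply, Set.mem_Ioc]
    split_ifs <;> simp_all
  have hint : ∀ s ∈ Set.Icc 0 v, ∀ i j k,
      IntervalIntegrable (fun r => if r ≤ u then b r i k * b r j k else 0) volume 0 s := by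
    intro s hs i j k
    rw [intervalIntegrable_iff_integrableOn_Ioc_of_le hs.1,
      ← integrable_indicator_iff measurableSet_Ioc, ← hind s hs]
    exact (memLp_indicator (hb i k) hs.2).integrable_mul (memLp_indicator (hb j k) hu.2)
  have hmain : ∀ s ∈ Set.Icc 0 v, ∀ i j, covMatrix P (noise A ξ s) (noise A ξ u) i j =
      ∫ r in (0 : ℝ)..s, (if r ≤ u then b r * (b r)ᵀ else 0) i j := by
    intro s hs i j
    simp only [hval]
    rw [intervalIntegral.integral_finsetSum fun k _ => hint s hs i j k]
    refine ((h.sde s hs i).covariance_eq hV (h.sde u hu j) (h.memLp_noise hV hv hA i hs)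
      (h.memLp_noise hV hv hA j hu) (fun k => memLp_indicator (hb i k) hs.2)
      (fun k => memLp_indicator (hb j k) hu.2)).trans (Finset.sum_congr rfl fun k _ => ?_)
    rw [hind s hs, integral_indicator measurableSet_Ioc, intervalIntegral.integral_of_le hs.1]
  refine ⟨fun i j => ?_, fun s hs i j => ?_⟩
  · simp only [hval]
    exact (IntervalIntegrable.sum Finset.univ fun k _ => hint v ⟨hv, le_rfl⟩ i j k).congr
      fun r _ => by simp
  · rw [hmain s hs, hmain 0 ⟨le_rfl, hv⟩]
    simp

/-- The covariance function of the solution of a linear stochastic differential equation, in terms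
of the fundamental matrix `Φ` and of its inverse `Ψ`. -/
theorem covMatrix_eq (h : IsLinearSolution P V v A b ξ) (hV : IsBrownianVec P V) (hv : 0 ≤ v)
    (hA : ∀ i j, IntervalIntegrable (fun r => A r i j) volume 0 v)
    (hb : ∀ i k, MemLp ((Set.Ioc 0 v).indicator fun r => b r i k) 2 volume)
    (hΨ0 : Ψ 0 = 1) (hΨ : IsPrimitiveOn 0 v Ψ (fun r => -(Ψ r * A r)))
    (hΨΦ : ∀ s ∈ Set.Icc 0 v, Ψ s * Φ s = 1) {S : ℝ → Matrix (Fin d) (Fin d) ℝ}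
    (hS0 : S 0 = covMatrix P (ξ 0) (ξ 0))
    (hS : IsPrimitiveOn 0 v S (fun r => Ψ r * (b r * (b r)ᵀ) * (Ψ r)ᵀ)) {s u : ℝ} (hs : 0 ≤ s)
    (hsu : s ≤ u) (hu : u ≤ v) : covMatrix P (ξ s) (ξ u) = Φ s * S s * (Φ u)ᵀ := by
  have hum : u ∈ Set.Icc 0 v := ⟨hs.trans hsu, hu⟩
  have hξL := h.isSquareBounded hV hv hA hb
  have hΦ_of : ∀ {X Y : Matrix (Fin d) (Fin d) ℝ} {s : ℝ}, s ∈ Set.Icc 0 v → Ψ s * X = Y →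
      X = Φ s * Y := by
    intro X Y s hs hXY
    rw [← hXY, ← Matrix.mul_assoc, mul_eq_one_comm.1 (hΨΦ s hs), Matrix.one_mul]
  -- The initial value is uncorrelated with the noise.
  have h0 : ∀ s ∈ Set.Icc 0 v, covMatrix P (ξ s) (ξ 0) = Φ s * covMatrix P (ξ 0) (ξ 0) := by
    intro s hs
    have hn : ∀ s ∈ Set.Icc 0 v, (0 : Matrix (Fin d) (Fin d) ℝ) =
        covMatrix P (noise A ξ s) (ξ 0) := by
      intro s hs
      ext i j
      simp only [covMatrix, Matrix.of_apply, Matrix.zero_apply]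
      rw [covariance_comm]
      exact ((h.sde s hs i).covariance_eq_zero hV (h.memLp_noise hV hv hA i hs) (h.memLp_zero j)
        (h.indep_zero.comp (measurable_pi_apply j) measurable_id)).symm
    have hz : IsPrimitiveOn 0 v (fun s => covMatrix P (noise A ξ s) (ξ 0)) 0 :=
      (IsPrimitiveOn.const 0).congr hn (fun _ _ => rfl) hv
    have := (h.isPrimitiveOn_covMatrix hV hv hA hb hΨ h.memLp_zero ⟨hv, le_rfl⟩ hz).eq_of_zero
      (fun r _ => by simp) s hs
    rw [hΨ0, Matrix.one_mul] at this
    exact hΦ_of hs this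
  obtain ⟨G, hG0, hG⟩ : ∃ G : ℝ → Matrix (Fin d) (Fin d) ℝ, G 0 = 0 ∧
      IsPrimitiveOn 0 v G (fun r => Ψ r * (b r * (b r)ᵀ)) := by
    have hBi := intervalIntegrable_mul_left hv (hΨ.continuousOn hv)
      (h.covMatrix_noise hV hv hA hb (u := v) ⟨hv, le_rfl⟩).integrable
    have hBi' : ∀ i j, IntervalIntegrable (fun r => (Ψ r * (b r * (b r)ᵀ)) i j) volume 0 v := by
      intro i j
      refine (hBi i j).congr fun r hr => ?_
      rw [Set.uIoc_of_le hv] at hr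
      simp only [if_pos hr.2]
    exact IsPrimitiveOn.exists_primitive hBi' 0
  -- The noise at the earlier time `q` against the solution at the later time `u`.
  have hM : ∀ q, 0 ≤ q → q ≤ u → covMatrix P (ξ u) (noise A ξ q) = Φ u * G q := by
    intro q hq hqu
    have hqm : q ∈ Set.Icc 0 v := ⟨hq, hqu.trans hu⟩
    have hprim := h.isPrimitiveOn_covMatrix hV hv hA hb hΨ
      (fun j => h.memLp_noise hV hv hA j hqm) ⟨hv, le_rfl⟩ (h.covMatrix_noise hV hv hA hb hqm)
    refine hΦ_of hum ?_
    have hinit : Ψ 0 * covMatrix P (ξ 0) (noise A ξ q) = 0 := by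
      rw [hΨ0, Matrix.one_mul]
      ext i j
      exact (h.sde q hqm j).covariance_eq_zero hV (h.memLp_noise hV hv hA j hqm) (h.memLp_zero i)
        (h.indep_zero.comp (measurable_pi_apply i) measurable_id)
    have hq1 : Ψ q * covMatrix P (ξ q) (noise A ξ q) = G q := by
      have hd := ((hprim.mono le_rfl hqm.2 hq).sub (hG.mono le_rfl hqm.2 hq)).eq_of_zero
        (fun r hr => by simp [hr.2]) q ⟨hq, le_rfl⟩
      rw [hinit, hG0, sub_zero] at hd
      exact sub_eq_zero.1 hd
    have hq2 := hprim.mono hq hu hqu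
    rw [← hq1]
    ext i j
    rw [hq2.eq u ⟨hqu, le_rfl⟩ i j, add_eq_left, intervalIntegral.integral_of_le hqu]
    refine setIntegral_eq_zero_of_forall_eq_zero fun r hr => ?_
    simp [not_le.2 hr.1]
  have hN : IsPrimitiveOn 0 u (fun q => covMatrix P (noise A ξ q) (ξ u))
      (fun r => (Φ u * (Ψ r * (b r * (b r)ᵀ)))ᵀ) := by
    have := ((IsPrimitiveOn.const (α := 0) (β := u) (Φ u)).mul (hG.mono le_rfl hu hum.1)
      hum.1).transpose
    refine this.congr (fun q hq => ?_) (fun r _ => by simp) hum.1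
    rw [← hM q hq.1 hq.2, covMatrix_transpose]
  -- Finally the solution is paired with its own value at the later time `u`.
  have hfin := h.isPrimitiveOn_covMatrix hV hv hA hb hΨ (fun j => (hξL j).memLp u hum) hum hN
  have hS' := (hS.mono le_rfl hu hum.1).mul (IsPrimitiveOn.const (Φ u)ᵀ) hum.1
  have hd := (hfin.sub hS').eq_of_zero (fun r _ => by
    simp only [Matrix.transpose_mul, Matrix.transpose_transpose, Pi.zero_apply, Matrix.mul_zero,
      add_zero, Matrix.mul_assoc, sub_self]) s ⟨hs, hsu⟩
  rw [hΨ0, Matrix.one_mul, hS0, ← covMatrix_transpose (ξ u) (ξ 0), h0 u hum, Matrix.transpose_mul,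
    covMatrix_transpose, sub_self] at hd
  rw [Matrix.mul_assoc]
  exact hΦ_of ⟨hs, hsu.trans hu⟩ (sub_eq_zero.1 hd)

end IsLinearSolution

end SDE

/-! ### The Riccati data and the dependence on the horizon -/

section

theorem abs_apply_le_frobenius {m n : ℕ} (A : Matrix (Fin m) (Fin n) ℝ) (i : Fin m) (j : Fin n) :
    |A i j| ≤ frobenius A := by
  rw [frobenius, ← Real.sqrt_sq_eq_abs]
  refine Real.sqrt_le_sqrt ?_
  exact (Finset.single_le_sum (f := fun j => A i j ^ 2) (fun j _ => sq_nonneg _)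
    (Finset.mem_univ j)).trans (Finset.single_le_sum (f := fun i => ∑ j, A i j ^ 2)
    (fun i _ => Finset.sum_nonneg fun j _ => sq_nonneg _) (Finset.mem_univ i))

theorem obsInfo_transpose {d₁ d₂ m₂ : ℕ} (c : Matrix (Fin d₂) (Fin d₁) ℝ)
    (σ : Matrix (Fin d₂) (Fin m₂) ℝ) : (obsInfo c σ)ᵀ = obsInfo c σ := by
  simp [obsInfo, Matrix.transpose_mul, Matrix.transpose_nonsing_inv, Matrix.mul_assoc]

/-- `initialCov S p` is the matrix `S (1 - p S)⁻¹`, and `1 - p S` is indeed invertible. -/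
theorem initialCov_mul {d : ℕ} {S p : Matrix (Fin d) (Fin d) ℝ} (hS : S.PosSemidef)
    (hp : (-p).PosSemidef) :
    initialCov S p * (1 - p * S) = S ∧ IsUnit (1 - p * S).det := by
  set R := CFC.sqrt S
  have hRR : R * R = S := CFC.sqrt_mul_sqrt_self S hS.nonneg
  have hR : Rᴴ = R := (Matrix.nonneg_iff_posSemidef.1 (CFC.sqrt_nonneg S)).isHermitian
  have hpos : (1 - R * p * R).PosDef := by
    have h := Matrix.PosDef.one.add_posSemidef (hp.conjTranspose_mul_mul_same R)
    rw [hR] at h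
    convert h using 1
    simp [sub_eq_add_neg]
  have hdet : IsUnit (1 - R * p * R).det := (Matrix.isUnit_iff_isUnit_det _).1 hpos.isUnit
  constructor
  · have e : R * (1 - p * S) = (1 - R * p * R) * R := by
      rw [← hRR]; noncomm_ring
    rw [initialCov, Matrix.mul_assoc, e, Matrix.mul_assoc, ← Matrix.mul_assoc _ _ R,
      Matrix.nonsing_inv_mul _ hdet, Matrix.one_mul, hRR]
  · have e : (1 - p * S).det = (1 - R * p * R).det := by
      rw [← hRR, ← Matrix.mul_assoc, Matrix.det_one_sub_mul_comm, ← Matrix.mul_assoc]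
    rwa [e]

theorem posSemidef_covMatrix {Ω : Type*} [MeasurableSpace Ω] {P : Measure Ω}
    [IsProbabilityMeasure P] {d : ℕ} {X : Ω → Fin d → ℝ} (hX : ∀ i, MemLp (fun ω => X ω i) 2 P) :
    (covMatrix P X X).PosSemidef := by
  refine Matrix.PosSemidef.of_dotProduct_mulVec_nonneg ?_ fun x => ?_
  · rw [Matrix.IsHermitian, Matrix.conjTranspose_eq_transpose_of_trivial, covMatrix_transpose]
  · have hvar := covariance_fun_sum_fun_sum (μ := P) (X := fun i ω => x i * X ω i)
      (Y := fun i ω => x i * X ω i) (fun i => (hX i).const_mul _) (fun i => (hX i).const_mul _)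
    have hm : MemLp (fun ω => ∑ i, x i * X ω i) 2 P :=
      memLp_finsetSum _ fun i _ => (hX i).const_mul _
    rw [covariance_self hm.aestronglyMeasurable.aemeasurable] at hvar
    have h0 := variance_nonneg (fun ω => ∑ i, x i * X ω i) P
    rw [hvar] at h0
    refine h0.trans_eq ?_
    simp only [dotProduct, Matrix.mulVec, star_trivial, Finset.mul_sum, covariance_const_mul_left,
      covariance_const_mul_right, covMatrix, Matrix.of_apply]
    exact Finset.sum_congr rfl fun i _ => Finset.sum_congr rfl fun j _ => by ring

variable {d₁ d₂ m₁ m₂ : ℕ} {a : ℝ → Matrix (Fin d₁) (Fin d₁) ℝ}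
  {b : ℝ → Matrix (Fin d₁) (Fin m₁) ℝ} {c : ℝ → Matrix (Fin d₂) (Fin d₁) ℝ}
  {σ : ℝ → Matrix (Fin d₂) (Fin m₂) ℝ} {t : ℝ} {p : ℝ → Matrix (Fin d₁) (Fin d₁) ℝ}

theorem Coefficients.intervalIntegrable_a (h : Coefficients a b c σ) (ht : 0 ≤ t) (i j : Fin d₁) :
    IntervalIntegrable (fun r => a r i j) volume 0 t := by
  rw [intervalIntegrable_iff_integrableOn_Icc_of_le ht]
  exact (h.integrable_a t ht).mono' (h.measurable_a i j).aestronglyMeasurable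
    (Eventually.of_forall fun r => abs_apply_le_frobenius _ _ _)

theorem Coefficients.memLp_b (h : Coefficients a b c σ) (ht : 0 ≤ t) (i : Fin d₁) (k : Fin m₁) :
    MemLp ((Set.Ioc 0 t).indicator fun r => b r i k) 2 volume := by
  rw [memLp_indicator_iff_restrict measurableSet_Ioc,
    memLp_two_iff_integrable_sq (h.measurable_b i k).aestronglyMeasurable]
  refine ((h.integrable_b t ht).mono_set Set.Ioc_subset_Icc_self).mono'
    ((h.measurable_b i k).pow_const 2).aestronglyMeasurable (Eventually.of_forall fun r => ?_)
  rw [Real.norm_of_nonneg (sq_nonneg _), ← sq_abs]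
  exact pow_le_pow_left₀ (abs_nonneg _) (abs_apply_le_frobenius _ _ _) 2

theorem Coefficients.intervalIntegrable_diffusion (h : Coefficients a b c σ) (ht : 0 ≤ t)
    (i j : Fin d₁) : IntervalIntegrable (fun r => (b r * (b r)ᵀ) i j) volume 0 t := by
  have : ∀ k, IntervalIntegrable (fun r => b r i k * b r j k) volume 0 t := by
    intro k
    rw [intervalIntegrable_iff_integrableOn_Ioc_of_le ht]
    exact ((memLp_indicator_iff_restrict measurableSet_Ioc).1 (h.memLp_b ht i k)).integrable_mul
      ((memLp_indicator_iff_restrict measurableSet_Ioc).1 (h.memLp_b ht j k))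
  simp only [Matrix.mul_apply, Matrix.transpose_apply]
  exact (IntervalIntegrable.sum Finset.univ fun k _ => this k).congr fun r _ => by simp

namespace IsRiccatiSolution

theorem transpose (hp : IsRiccatiSolution a b c σ t p) : ∀ s ∈ Set.Icc 0 t, (p s)ᵀ = p s := by
  intro s hs
  have := (hp.negSemidef s hs).isHermitian
  rwa [Matrix.IsHermitian, Matrix.conjTranspose_eq_transpose_of_trivial, Matrix.transpose_neg,
    neg_inj] at this

theorem terminal (hp : IsRiccatiSolution a b c σ t p) (ht : 0 ≤ t) : p t = 0 := by
  ext i j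
  rw [hp.equation t ⟨ht, le_rfl⟩]
  simp

theorem isPrimitiveOn (hp : IsRiccatiSolution a b c σ t p) (ht : 0 ≤ t) :
    IsPrimitiveOn 0 t p (fun r => -(p r * (b r * (b r)ᵀ) * p r) - (a r)ᵀ * p r - p r * a r +
      obsInfo (c r) (σ r)) := by
  have hrhs : ∀ r, -(p r * (b r * (b r)ᵀ) * p r) - (a r)ᵀ * p r - p r * a r +
      obsInfo (c r) (σ r) = riccatiRHS (a r) (b r) (c r) (σ r) (p r) := by
    intro r
    rw [riccatiRHS, ← Matrix.mul_assoc (p r) (b r)]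
  simp only [hrhs]
  refine ⟨hp.integrable, fun s hs i j => ?_⟩
  rw [hp.equation s hs, hp.equation 0 ⟨le_rfl, ht⟩]
  have := intervalIntegral.integral_add_adjacent_intervals
    (intervalIntegrable_mono (hp.integrable i j) le_rfl hs.1 hs.2)
    (intervalIntegrable_mono (hp.integrable i j) hs.1 hs.2 le_rfl)
  linarith

theorem intervalIntegrable_drift (hp : IsRiccatiSolution a b c σ t p) (h : Coefficients a b c σ)
    (ht : 0 ≤ t) (i j : Fin d₁) :
    IntervalIntegrable (fun r => (a r + b r * (b r)ᵀ * p r) i j) volume 0 t :=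
  (h.intervalIntegrable_a ht i j).add (intervalIntegrable_mul_right ht
    ((hp.isPrimitiveOn ht).continuousOn ht) (h.intervalIntegrable_diffusion ht) i j)

/-- The integrability of `cᵀ (σ σᵀ)⁻¹ c` follows from that of the other terms of the Riccati
equation. -/
theorem intervalIntegrable_obsInfo (hp : IsRiccatiSolution a b c σ t p)
    (h : Coefficients a b c σ) (ht : 0 ≤ t) (i j : Fin d₁) :
    IntervalIntegrable (fun r => obsInfo (c r) (σ r) i j) volume 0 t := by
  have hpc := (hp.isPrimitiveOn ht).continuousOn ht
  have ha := h.intervalIntegrable_a ht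
  have h1 := intervalIntegrable_mul_right ht hpc (intervalIntegrable_mul_left ht hpc
    (h.intervalIntegrable_diffusion ht)) i j
  have h2 := intervalIntegrable_mul_right (H := fun r => (a r)ᵀ) ht hpc (fun i j => ha j i) i j
  have h3 := intervalIntegrable_mul_left ht hpc ha i j
  refine (((((hp.isPrimitiveOn ht).integrable i j).add h1).add h2).add h3).congr fun r _ => ?_
  simp only [Matrix.add_apply, Matrix.sub_apply, Matrix.neg_apply]
  ring

end IsRiccatiSolution

theorem IsXi.isLinearSolution {Ω : Type*} [MeasurableSpace Ω] {P : Measure Ω}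
    {S : Matrix (Fin d₁) (Fin d₁) ℝ} {V : Fin m₁ → ℝ≥0 → Ω → ℝ} {ξ : ℝ → Ω → Fin d₁ → ℝ}
    (h : IsXi P a b S V t p ξ) :
    IsLinearSolution P V t (fun r => a r + b r * (b r)ᵀ * p r) b ξ :=
  ⟨fun i => (h.gaussian_zero.eval i).memLp_two, h.indep_zero, h.aemeasurable, h.continuous, h.sde⟩

/-- The covariance equation for `s ≤ u`; the other case follows by transposition. -/
theorem isPrimitiveOn_covMatrix_horizon {Ω : Type*} [MeasurableSpace Ω] {P : Measure Ω}
    [IsProbabilityMeasure P] (hcoeff : Coefficients a b c σ)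
    {X₀ : Ω → Fin d₁ → ℝ} (hX₀ : HasGaussianLaw X₀ P)
    {V : Fin m₁ → ℝ≥0 → Ω → ℝ} (hV : IsBrownianVec P V)
    {φ : ℝ → ℝ → Matrix (Fin d₁) (Fin d₁) ℝ}
    (hφ : ∀ t, 0 ≤ t → IsRiccatiSolution a b c σ t (fun s => φ s t))
    {ξ : ℝ → ℝ → Ω → Fin d₁ → ℝ}
    (hξ : ∀ t, 0 ≤ t → IsXi P a b (covMatrix P X₀ X₀) V t (fun s => φ s t) (fun s => ξ s t))
    {T : ℝ} (hT : 0 ≤ T) (s u : ℝ) (hs : 0 ≤ s) (hsu : s ≤ u) (huT : u ≤ T) :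
    IsPrimitiveOn u T (fun v => covMatrix P (ξ s v) (ξ u v)) (fun v =>
      -((covMatrix P (ξ v v) (ξ s v))ᵀ * obsInfo (c v) (σ v) * covMatrix P (ξ v v) (ξ u v))) := by
  have hB : ∀ r, (b r * (b r)ᵀ)ᵀ = b r * (b r)ᵀ := fun r => by simp [Matrix.transpose_mul]
  have hh : ∀ r, (obsInfo (c r) (σ r))ᵀ = obsInfo (c r) (σ r) := fun r => obsInfo_transpose _ _
  have hai := hcoeff.intervalIntegrable_a hT
  have hBi := hcoeff.intervalIntegrable_diffusion hT
  have hhi := (hφ T hT).intervalIntegrable_obsInfo hcoeff hT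
  have hS₀ := posSemidef_covMatrix (P := P) fun i => (hX₀.eval i).memLp_two
  obtain ⟨U, W, hU0, hW0, hUW⟩ := exists_isHamiltonianOn (a := a) (B := fun r => b r * (b r)ᵀ)
    (h := fun r => obsInfo (c r) (σ r)) hT hai hBi hhi (covMatrix P X₀ X₀) 1
  have key : ∀ v ∈ Set.Icc 0 T, IsUnit (W v).det ∧ ∀ s u, 0 ≤ s → s ≤ u → u ≤ v →
      ∀ Q R : ℝ → Matrix (Fin d₁) (Fin d₁) ℝ, Q u = 0 → R u = 1 →
      IsHamiltonianOn u v a (fun r => b r * (b r)ᵀ) (fun r => obsInfo (c r) (σ r)) Q R →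
      covMatrix P (ξ s v) (ξ u v) = U s * (W v)⁻¹ * R v := by
    intro v ⟨hv, hvT⟩
    have hp := hφ v hv
    have hx := hξ v hv
    have hA := hp.intervalIntegrable_drift hcoeff hv
    obtain ⟨Φ, Ψ, hΦ0, hΨ0, hΦ, hΨ, hΨΦ⟩ := exists_fundamental hv hA
    have hΨc := hΨ.continuousOn hv
    obtain ⟨S, hS0, hS⟩ := IsPrimitiveOn.exists_primitive
      (intervalIntegrable_mul_right hv (fun i j => hΨc j i) (intervalIntegrable_mul_left hv hΨc
        (hcoeff.intervalIntegrable_diffusion hv))) (covMatrix P (ξ 0 v) (ξ 0 v))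
    obtain ⟨hC1, hC2⟩ := initialCov_mul hS₀ (hp.negSemidef 0 ⟨le_rfl, hv⟩)
    obtain ⟨hdet, hform⟩ := fundamental_mul_eq_hamiltonian (S := S) hv hB hp.transpose
      (hp.terminal hv) (hp.isPrimitiveOn hv) hΦ0 hΨ0 hΦ hΨ hΨΦ hS
      (by rw [hS0, hx.cov_zero, hC1]) hC2 hU0 hW0 (hUW.mono le_rfl hvT hv)
    refine ⟨hdet, fun s u hs hsu huv Q R hQ hR hQR => ?_⟩
    rw [← hform s u hs (hs.trans hsu) (hsu.trans huv) huv Q R hQ hR hQR]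
    exact hx.isLinearSolution.covMatrix_eq hV hv hA (hcoeff.memLp_b hv) hΨ0 hΨ hΨΦ hS0 hS hs hsu huv
  exact isPrimitiveOn_horizon hB hh hai hBi hhi (covMatrix_transpose _ _) hU0 hW0 hUW
    (fun v hv => (key v hv).1) (fun v s u => covMatrix P (ξ s v) (ξ u v))
    (fun v s u => covMatrix_transpose _ _)
    (fun v s u hs hsu huv hvT => (key v ⟨hs.trans (hsu.trans huv), hvT⟩).2 s u hs hsu huv)
    hs hsu huT

end

end LinearFiltering

theorem mainTheorem9 {Ω : Type*} [MeasurableSpace Ω] (P : Measure Ω) [IsProbabilityMeasure P]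
    {d₁ d₂ m₁ m₂ : ℕ}
    (a : ℝ → Matrix (Fin d₁) (Fin d₁) ℝ) (b : ℝ → Matrix (Fin d₁) (Fin m₁) ℝ)
    (c : ℝ → Matrix (Fin d₂) (Fin d₁) ℝ) (σ : ℝ → Matrix (Fin d₂) (Fin m₂) ℝ)
    (hcoeff : LinearFiltering.Coefficients a b c σ)
    (X₀ : Ω → Fin d₁ → ℝ) (hX₀ : HasGaussianLaw X₀ P)
    (V : Fin m₁ → ℝ≥0 → Ω → ℝ) (hV : LinearFiltering.IsBrownianVec P V)
    (φ : ℝ → ℝ → Matrix (Fin d₁) (Fin d₁) ℝ)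
    (hφ : ∀ t, 0 ≤ t → LinearFiltering.IsRiccatiSolution a b c σ t (fun s => φ s t))
    (ξ : ℝ → ℝ → Ω → Fin d₁ → ℝ)
    (hξ : ∀ t, 0 ≤ t → LinearFiltering.IsXi P a b (LinearFiltering.covMatrix P X₀ X₀) V t
      (fun s => φ s t) (fun s => ξ s t)) :
    (∀ s t, 0 ≤ s → s ≤ t → ∀ i, MemLp (fun ω => ξ s t ω i) 2 P) ∧
    ∀ s u t, 0 ≤ s → 0 ≤ u → max s u ≤ t → ∀ i j,
      IntervalIntegrable (fun v =>
        ((LinearFiltering.covMatrix P (ξ v v) (ξ s v))ᵀ * (c v)ᵀ * (σ v * (σ v)ᵀ)⁻¹ * c v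
          * LinearFiltering.covMatrix P (ξ v v) (ξ u v)) i j) volume (max s u) t ∧
      LinearFiltering.covMatrix P (ξ s t) (ξ u t) i j =
        LinearFiltering.covMatrix P (ξ s (max s u)) (ξ u (max s u)) i j +
        ∫ v in (max s u)..t,
          (-((LinearFiltering.covMatrix P (ξ v v) (ξ s v))ᵀ * (c v)ᵀ * (σ v * (σ v)ᵀ)⁻¹ * c v
            * LinearFiltering.covMatrix P (ξ v v) (ξ u v))) i j := by
  constructor
  · intro s t hs hst i
    have ht := hs.trans hst
    exact ((hξ t ht).isLinearSolution.isSquareBounded hV ht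
      ((hφ t ht).intervalIntegrable_drift hcoeff ht) (hcoeff.memLp_b ht) i).memLp s ⟨hs, hst⟩
  · intro s u t hs hu hmax i j
    have hprim : LinearFiltering.IsPrimitiveOn (max s u) t
        (fun v => LinearFiltering.covMatrix P (ξ s v) (ξ u v)) (fun v =>
        -((LinearFiltering.covMatrix P (ξ v v) (ξ s v))ᵀ * (c v)ᵀ * (σ v * (σ v)ᵀ)⁻¹ * c v
            * LinearFiltering.covMatrix P (ξ v v) (ξ u v))) := by
      have ht : 0 ≤ t := hs.trans ((le_max_left _ _).trans hmax)
      have main := LinearFiltering.isPrimitiveOn_covMatrix_horizon hcoeff hX₀ hV hφ hξ ht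
      rcases le_total s u with hsu | hus
      · rw [max_eq_right hsu] at hmax ⊢
        refine (main s u hs hsu hmax).congr (fun _ _ => rfl) (fun v _ => ?_) hmax
        simp only [LinearFiltering.obsInfo, Matrix.mul_assoc]
      · rw [max_eq_left hus] at hmax ⊢
        refine (main u s hu hus hmax).transpose.congr
          (fun v _ => LinearFiltering.covMatrix_transpose _ _) (fun v _ => ?_) hmax
        rw [Matrix.transpose_neg, Matrix.transpose_mul, Matrix.transpose_mul,
          LinearFiltering.obsInfo_transpose, Matrix.transpose_transpose]
        simp only [LinearFiltering.obsInfo, Matrix.mul_assoc]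
    refine ⟨(hprim.integrable i j).neg.congr fun v _ => ?_, hprim.eq t ⟨hmax, le_rfl⟩ i j⟩
    simp
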